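/- Let $K$ be a field and let $S=K[X_1,\dots,X_n]$ with the standard grading, $S_+=(X_1,\dots,X_n)$, and $K=S/S_+$ regarded as a graded $S$-module in degree $0$. For a graded $S$-module $N$ put $\operatorname{reg} N=\sup\{\,i+j \mid H^i_{S_+}(N)_j\neq 0\,\}$ (so $\operatorname{reg} 0=-\infty$), and for a finitely generated graded $S$-module $N$ put $t_i(N)=\operatorname{reg}\operatorname{Tor}^S_i(N,K)$. The grade of a finitely generated $S$-module $N$ is $\inf\{i\mid \operatorname{Ext}^i_S(N,S)\ne 0\}$, the grade of an ideal $I$ is the grade of $S/I$, and $N$ is called perfect of grade $m$ if its grade and its projective dimension are both equal to the integer $m$. Let $I\subseteq S$ be a homogeneous ideal of (finite) grade $g$, and let $\mathbf{x}=x_1,\dots,x_l$ be a (not necessarily minimal) system of homogeneous generators of $I$, of degrees $|x_1|\ge|x_2|\ge\dots\ge|x_l|$. Let $M$ be a finitely generated ($\mathbb{Z}$-)graded $S$-module which is perfect of grade $n-g$ and such that $M/IM$ has finite length. Let $H_k(\mathbf{x},M)$ be the Koszul homology modules, graded so that the basis element $e_{i_1}\wedge\dots\wedge e_{i_k}$ of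 the Koszul complex has degree $|x_{i_1}|+\dots+|x_{i_k}|$. Then for every $k\ge 0$ $$\operatorname{reg} H_k(\mathbf{x},M)\;\le\;\sum_{i=1}^{g+k}|x_i|+t_{n-g}(M)-n ,$$ where terms with $i>l$ in the sum are omitted. -/

import Mathlib

open scoped TensorProduct

universe u v w

namespace KoszulReg

/-! ### Subquotients with an induced family of homogeneous components -/

section Subquotient

variable {R : Type u} [CommRing R] {A : Type v} [AddCommGroup A] [Module R A]

/-- The subquotient `Z / B` of a module `A` (used with `Z` cycles and `B ≤ Z` boundaries). -/
abbrev SubQuot (Z B : Submodule R A) : Type v := Z ⧸ B.submoduleOf Z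

/-- The homogeneous components induced on `Z / B`: the component of degree `j` consists of the
classes of the elements of `Z` that are homogeneous of degree `j` in `A`. -/
def subQuotPart (𝓐 : ℤ → AddSubgroup A) (Z B : Submodule R A) (j : ℤ) :
    AddSubgroup (SubQuot Z B) :=
  ((𝓐 j).comap Z.subtype.toAddMonoidHom).map (B.submoduleOf Z).mkQ.toAddMonoidHom

end Subquotient

/-! ### The Koszul complex with coefficients in a module -/

section Koszul

variable {R : Type u} [CommRing R] {l : ℕ} (x : Fin l → R) (d : Fin l → ℕ)
variable {M : Type v} [AddCommGroup M] [Module R M]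

variable (l M) in
/-- `K_k(x, M)`: the module `⨁_{|σ| = k} M e_σ`, with
`e_σ = e_{i₁} ∧ ⋯ ∧ e_{i_k}` for `σ = {i₁ < ⋯ < i_k}`. -/
abbrev KoszulChain (k : ℕ) : Type v := {σ : Finset (Fin l) // σ.card = k} → M

variable (M) in
/-- The Koszul differential `K_{k+1}(x, M) → K_k(x, M)`,
`m e_{i₀} ∧ ⋯ ∧ e_{i_k} ↦ ∑_r (-1)^r x_{i_r} m e_{i₀} ∧ ⋯ ê_{i_r} ⋯ ∧ e_{i_k}`,
written through the coefficients of the basis elements `e_σ` with `|σ| = k`. -/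
def koszulD (k : ℕ) : KoszulChain l M (k + 1) →ₗ[R] KoszulChain l M k :=
  LinearMap.pi fun σ => ∑ s : {s : Fin l // s ∉ σ.1},
    ((-1 : R) ^ (σ.1.filter (· < s.1)).card * x s.1) •
      LinearMap.proj (R := R) (φ := fun _ => M)
        ⟨insert s.1 σ.1, by rw [Finset.card_insert_of_notMem s.2, σ.2]⟩

variable (M) in
/-- The Koszul cycles in `K_k(x, M)`. -/
def koszulCycles : (k : ℕ) → Submodule R (KoszulChain l M k)
  | 0 => ⊤
  | k + 1 => LinearMap.ker (koszulD x M k)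

variable (M) in
/-- The Koszul homology module `H_k(x, M)`. -/
abbrev KoszulHomology (k : ℕ) : Type v :=
  SubQuot (koszulCycles x M k) (LinearMap.range (koszulD x M k))

/-- The homogeneous elements of degree `j` in `K_k(x, M)`, where `e_σ` has degree
`∑_{s ∈ σ} d s`. -/
def koszulChainPart (𝓜 : ℤ → AddSubgroup M) (k : ℕ) (j : ℤ) :
    AddSubgroup (KoszulChain l M k) where
  carrier := {c | ∀ σ : {σ : Finset (Fin l) // σ.card = k}, c σ ∈ 𝓜 (j - ∑ s ∈ σ.1, (d s : ℤ))}
  add_mem' ha hb := fun σ => add_mem (ha σ) (hb σ)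
  zero_mem' := fun _ => zero_mem _
  neg_mem' ha := fun σ => neg_mem (ha σ)

/-- The grading of `H_k(x, M)`. -/
def koszulHomologyPart (𝓜 : ℤ → AddSubgroup M) (k : ℕ) : ℤ → AddSubgroup (KoszulHomology x M k) :=
  subQuotPart (koszulChainPart d 𝓜 k) _ _

end Koszul

/-! ### Graded modules -/

/-- `𝓜` is a `ℤ`-grading of the `R`-module `M`, for the grading `𝓡` of the ring `R`:
`M = ⨁_j 𝓜 j` and `𝓡 i • 𝓜 j ⊆ 𝓜 (i + j)`. -/
structure IsGradedModule {R : Type u} [CommRing R] (𝓡 : ℤ → AddSubgroup R)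
    {M : Type v} [AddCommGroup M] [Module R M] (𝓜 : ℤ → AddSubgroup M) : Prop where
  isInternal : DirectSum.IsInternal 𝓜
  smul_mem : ∀ (i j : ℤ) (p : R) (m : M), p ∈ 𝓡 i → m ∈ 𝓜 j → p • m ∈ 𝓜 (i + j)

/-! ### Graded local cohomology by the Čech complex, and regularity

Here `R` is a ring with grading `𝓡`, and `y₁, …, yₙ` are homogeneous elements of `R`; the local
cohomology has support in `(y₁, …, yₙ)`. -/

section Cech

variable {R : Type u} [CommRing R] (𝓡 : ℤ → AddSubgroup R) {n : ℕ} (y : Fin n → R)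
variable {M : Type v} [AddCommGroup M] [Module R M]

/-- The multiplicative set generated by the `y_s`, `s ∈ σ`. -/
def cechMonoid (σ : Finset (Fin n)) : Submonoid R :=
  Submonoid.closure (y '' (σ : Set (Fin n)))

theorem cechMonoid_mono {σ τ : Finset (Fin n)} (h : σ ⊆ τ) :
    cechMonoid y σ ≤ cechMonoid y τ :=
  Submonoid.closure_mono (Set.image_mono (Finset.coe_subset.mpr h))

variable (M) in
/-- The localization of `M` at the product of the `y_s`, `s ∈ σ`. -/
abbrev CechLoc (σ : Finset (Fin n)) : Type (max u v) := LocalizedModule (cechMonoid y σ) M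

variable (M) in
/-- The localization map between two terms of the Čech complex. -/
noncomputable def cechRes {σ τ : Finset (Fin n)} (h : σ ⊆ τ) : CechLoc y M σ →ₗ[R] CechLoc y M τ :=
  IsLocalizedModule.liftOfLE (cechMonoid y σ) (cechMonoid y τ) (cechMonoid_mono y h)
    (LocalizedModule.mkLinearMap (cechMonoid y σ) M)
    (LocalizedModule.mkLinearMap (cechMonoid y τ) M)

/-- The component of degree `j` of the localization: it is generated by the fractions `m / p` with
`p` of some degree `e` in the multiplicative set and `m` homogeneous of degree `j + e`. -/
def cechLocPart (𝓜 : ℤ → AddSubgroup M) (σ : Finset (Fin n)) (j : ℤ) :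
    AddSubgroup (CechLoc y M σ) :=
  AddSubgroup.closure {z | ∃ (p : cechMonoid y σ) (e : ℤ) (m : M),
    (p : R) ∈ 𝓡 e ∧ m ∈ 𝓜 (j + e) ∧ z = LocalizedModule.mk m p}

variable (M) in
/-- The term `⨁_{|σ| = i} M_{y_σ}` of the Čech complex of `M` on `y₁, …, yₙ`. -/
abbrev CechCochain (i : ℕ) : Type (max u v) :=
  (σ : {σ : Finset (Fin n) // σ.card = i}) → CechLoc y M σ.1

variable (M) in
/-- The Čech differential. -/
noncomputable def cechD (i : ℕ) : CechCochain y M i →ₗ[R] CechCochain y M (i + 1) :=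
  LinearMap.pi fun τ => ∑ s : {s : Fin n // s ∈ τ.1},
    ((-1 : R) ^ (τ.1.filter (· < s.1)).card) •
      (cechRes y M (Finset.erase_subset s.1 τ.1)).comp
        (LinearMap.proj (R := R)
          (φ := fun σ : {σ : Finset (Fin n) // σ.card = i} => CechLoc y M σ.1)
          ⟨τ.1.erase s.1, by rw [Finset.card_erase_of_mem s.2, τ.2, Nat.add_sub_cancel]⟩)

variable (M) in
/-- The Čech coboundaries. -/
noncomputable def cechBoundaries : (i : ℕ) → Submodule R (CechCochain y M i)
  | 0 => ⊥
  | i + 1 => LinearMap.range (cechD y M i)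

variable (M) in
/-- The local cohomology module `H^i_{(y)}(M)`. -/
abbrev LocalCohomology (i : ℕ) : Type (max u v) :=
  SubQuot (LinearMap.ker (cechD y M i)) (cechBoundaries y M i)

/-- The homogeneous elements of degree `j` in the `i`-th term of the Čech complex. -/
def cechCochainPart (𝓜 : ℤ → AddSubgroup M) (i : ℕ) (j : ℤ) :
    AddSubgroup (CechCochain y M i) where
  carrier := {c | ∀ σ, c σ ∈ cechLocPart 𝓡 y 𝓜 σ.1 j}
  add_mem' ha hb := fun σ => add_mem (ha σ) (hb σ)
  zero_mem' := fun _ => zero_mem _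
  neg_mem' ha := fun σ => neg_mem (ha σ)

/-- The component `H^i_{(y)}(M)_j`. -/
noncomputable def localCohomologyPart (𝓜 : ℤ → AddSubgroup M) (i : ℕ) (j : ℤ) :
    AddSubgroup (LocalCohomology y M i) :=
  subQuotPart (cechCochainPart 𝓡 y 𝓜 i) _ _ j

/-- `max {i + j | H^i_{(y)}(M)_j ≠ 0}`, with value in the extended reals; it is `-∞` for `M = 0`. -/
noncomputable def cechReg (𝓜 : ℤ → AddSubgroup M) : EReal :=
  ⨆ (i : ℕ) (j : ℤ) (_ : localCohomologyPart 𝓡 y 𝓜 i j ≠ ⊥), (((i + j : ℤ) : ℝ) : EReal)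

end Cech

/-! ### Graded Tor, by a functorial graded free resolution -/

/-- An `R`-module together with a family of additive subgroups (its homogeneous components). -/
structure GrMod (R : Type u) [CommRing R] where
  carrier : Type u
  [addCommGroup : AddCommGroup carrier]
  [module : Module R carrier]
  part : ℤ → AddSubgroup carrier

attribute [instance] GrMod.addCommGroup GrMod.module

namespace GrMod

variable {R : Type u} [CommRing R] (𝓡 : ℤ → AddSubgroup R) (N : GrMod R)

/-- The free module `F(N)` with one basis element for each homogeneous element of `N`. -/
abbrev Free : Type u := (Σ j : ℤ, N.part j) →₀ R

/-- The grading of `F(N)` for which the basis element of an element of degree `i` has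
degree `i`. -/
def freePart (j : ℤ) : AddSubgroup N.Free where
  carrier := {f | ∀ b, f b ∈ 𝓡 (j - b.1)}
  add_mem' ha hb := fun b => add_mem (ha b) (hb b)
  zero_mem' := fun _ => zero_mem _
  neg_mem' ha := fun b => neg_mem (ha b)

/-- The canonical map `F(N) → N`, which sends a basis element to the element it stands for; it is
surjective if `N` is a graded module. -/
noncomputable def cover : N.Free →ₗ[R] N.carrier :=
  Finsupp.linearCombination R fun b => (b.2 : N.carrier)

/-- The graded module `ker (F(N) → N)`. -/
noncomputable def syzygy : GrMod R where
  carrier := LinearMap.ker N.cover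
  part j := (N.freePart 𝓡 j).comap (LinearMap.ker N.cover).subtype.toAddMonoidHom

/-- The iterated syzygies `N, ker (F(N) → N), …`. -/
noncomputable def iterSyzygy : ℕ → GrMod R
  | 0 => N
  | i + 1 => (iterSyzygy i).syzygy 𝓡

/-- The composition `F(ker (F(N) → N)) → ker (F(N) → N) ⊆ F(N)`. -/
noncomputable def connect : (N.syzygy 𝓡).Free →ₗ[R] N.Free :=
  (LinearMap.ker N.cover).subtype.comp (N.syzygy 𝓡).cover

/-- The `i`-th module `F_i` of the canonical graded free resolution `⋯ → F₁ → F₀ → N → 0`. -/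
abbrev Res (i : ℕ) : Type u := (N.iterSyzygy 𝓡 i).Free

/-- The differential `F_{i+1} → F_i` of the canonical resolution. -/
noncomputable def resD (i : ℕ) : N.Res 𝓡 (i + 1) →ₗ[R] N.Res 𝓡 i := (N.iterSyzygy 𝓡 i).connect 𝓡

/-! In what follows `R / J` is considered as a graded module generated in degree `0`. -/

variable (J : Ideal R)

/-- The term `F_i ⊗ R/J`. -/
abbrev TorChain (i : ℕ) : Type u := N.Res 𝓡 i ⊗[R] (R ⧸ J)

/-- The differential `F_{i+1} ⊗ R/J → F_i ⊗ R/J`. -/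
noncomputable def torD (i : ℕ) : N.TorChain 𝓡 J (i + 1) →ₗ[R] N.TorChain 𝓡 J i :=
  (N.resD 𝓡 i).rTensor (R ⧸ J)

/-- The cycles of `F ⊗ R/J`. -/
noncomputable def torCycles : (i : ℕ) → Submodule R (N.TorChain 𝓡 J i)
  | 0 => ⊤
  | i + 1 => LinearMap.ker (N.torD 𝓡 J i)

/-- The boundaries of `F ⊗ R/J`. -/
noncomputable def torBoundaries (i : ℕ) : Submodule R (N.TorChain 𝓡 J i) :=
  LinearMap.range (N.torD 𝓡 J i)

/-- `Tor_i(N, R/J) = H_i(F ⊗ R/J)`. -/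
abbrev Tor (i : ℕ) : Type u :=
  SubQuot (A := N.TorChain 𝓡 J i) (N.torCycles 𝓡 J i) (N.torBoundaries 𝓡 J i)

/-- The homogeneous elements of degree `j` of `F_i ⊗ R/J`: the image of those of `F_i`. -/
noncomputable def torChainPart (i : ℕ) (j : ℤ) : AddSubgroup (N.TorChain 𝓡 J i) :=
  ((N.iterSyzygy 𝓡 i).freePart 𝓡 j).map
    ((TensorProduct.mk R (N.Res 𝓡 i) (R ⧸ J)).flip 1).toAddMonoidHom

/-- The grading of `Tor_i(N, R/J)`. -/
noncomputable def torPart (i : ℕ) : ℤ → AddSubgroup (N.Tor 𝓡 J i) :=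
  subQuotPart (A := N.TorChain 𝓡 J i) (N.torChainPart 𝓡 J i) _ _

end GrMod

/-! ### The polynomial ring -/

section Poly

variable {n : ℕ} {K : Type u} [Field K]

/-- `S = K[X₁, …, Xₙ]`. -/
abbrev Poly (n : ℕ) (K : Type u) [Field K] : Type u := MvPolynomial (Fin n) K

variable (n K) in
/-- The component `S_e` of the standard grading of `S`, for `e ∈ ℤ` (zero for `e < 0`). -/
noncomputable def polyPart (e : ℤ) : AddSubgroup (Poly n K) :=
  if 0 ≤ e then (MvPolynomial.homogeneousSubmodule (Fin n) K e.toNat).toAddSubgroup else ⊥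

variable (n K) in
/-- The ideal `S₊ = (X₁, …, Xₙ)`, so that `K = S / S₊`. -/
noncomputable abbrev irrelevant : Ideal (Poly n K) :=
  Ideal.span (Set.range (MvPolynomial.X : Fin n → Poly n K))

/-- The Castelnuovo–Mumford regularity `reg M = max {i + j | H^i_{S₊}(M)_j ≠ 0}` of the
`S`-module `M` with grading `𝓜`. -/
noncomputable def reg {M : Type v} [AddCommGroup M] [Module (Poly n K) M]
    (𝓜 : ℤ → AddSubgroup M) : EReal :=
  cechReg (polyPart n K) (MvPolynomial.X : Fin n → Poly n K) 𝓜

/-- `t_i(M) = reg Tor_i(M, K)`. -/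
noncomputable def tReg {M : Type u} [AddCommGroup M] [Module (Poly n K) M]
    (𝓜 : ℤ → AddSubgroup M) (i : ℕ) : EReal :=
  reg (n := n) (K := K)
    ((GrMod.mk (R := Poly n K) M 𝓜).torPart (polyPart n K) (irrelevant n K) i)

end Poly

/-! ### Grade and perfection -/

section Perfect

variable (R : Type u) [CommRing R]

/-- The grade of a module, `grade N = min {i | Ext^i_R(N, R) ≠ 0}`, which is `∞` if there is no
such `i`. -/
noncomputable def moduleGrade (N : Type u) [AddCommGroup N] [Module R N] : ℕ∞ :=
  ⨅ (i : ℕ) (_ : Nontrivial (CategoryTheory.Abelian.Ext.{u} (ModuleCat.of R N) (ModuleCat.of R R) i)),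
    (i : ℕ∞)

/-- `grade I = grade (R / I)`, the length of every maximal regular sequence in `I` if `R` is
Noetherian and `I ≠ R`. -/
noncomputable def idealGrade (I : Ideal R) : ℕ∞ := moduleGrade R (R ⧸ I)

/-- `N` is perfect of grade `m`: its projective dimension and its grade are both `m`. -/
def IsPerfectOfGrade (N : Type u) [AddCommGroup N] [Module R N] (m : ℕ) : Prop :=
  moduleGrade R N = m ∧ CategoryTheory.projectiveDimension (ModuleCat.of R N) = (m : ℕ∞)

end Perfect

end KoszulReg

namespace KoszulReg

/-! Write p = n - g. The grade of M forces dim M ≤ n - p, and the proof (`exactAt_of_supportDim_le`)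
is an induction on r = n - p that cuts M down by homogeneous regular elements. The induction carries
four facts: dim M ≤ r; S₊ lies in the radical of (x) + Ann M; the Koszul homology H_i(X, M) on the
variables vanishes for i > n - r; and H_{n-r}(X, M) vanishes in degrees > τ. The conclusion is that
H_k(x, M) vanishes in degrees above the sum of the first k + r degrees plus τ - n.

If r = 0, then M is artinian and H_n(X, M) is its socle shifted by n. So M vanishes in degrees > τ -
n, and already the chains in K_k(x, M) satisfy the bound.

If r > 0, then H_n(X, M) = 0, so M has no socle, and prime avoidance gives a homogeneous M-regular
element of S₊. A power y of it, of degree e, lies in (x) + Ann M and hence kills H(x, M). The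
sequence 0 → M(-e) → M → M/yM → 0 is then used twice. Since y kills H(x, M), H_k(x, M)_j embeds in
H_{k+1}(x, M/yM)_{j+e} (`ExactAt.of_quotient`). Since H_{n-r+1}(X, M) = 0, H_{n-r+1}(X, M/yM)_q
embeds in H_{n-r}(X, M)_{q-e} (`ExactAt.quotient`). Passing to M/yM thus replaces (k, r, τ, j) by
(k+1, r-1, τ+e, j+e), which leaves the claimed inequality unchanged.

The hypotheses for the given M come from four sources. Finite length of M/IM and the determinant
trick give the radical condition (`mem_radical_of_smul_mem`). Ext vanishing gives the dimension
(`supportDim_add_le_of_subsingleton_ext`). Dimension shifting along the canonical free resolution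
compares H_i(X, M) with Tor_i(M, K) and with the projective dimension (`exactAt_of_torPart_eq_bot`,
`exactAt_top_of_projectiveDimension`). Finally, Tor and H_k(x, M) are torsion for S₊, so their
regularity is controlled by their degrees (`le_cechReg`, `cechReg_le`). -/

theorem subQuotPart_eq_bot_iff {R : Type u} [CommRing R] {A : Type v} [AddCommGroup A] [Module R A]
    {𝓐 : ℤ → AddSubgroup A} {Z B : Submodule R A} {j : ℤ} :
    subQuotPart 𝓐 Z B j = ⊥ ↔ ∀ z ∈ Z, z ∈ 𝓐 j → z ∈ B := by
  rw [subQuotPart, eq_bot_iff]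
  constructor
  · intro h z hz hzj
    have hz0 : (B.submoduleOf Z).mkQ ⟨z, hz⟩ = 0 := h ⟨⟨z, hz⟩, hzj, rfl⟩
    rwa [Submodule.mkQ_apply, Submodule.Quotient.mk_eq_zero] at hz0
  · rintro h _ ⟨⟨z, hz⟩, hzj, rfl⟩
    exact AddSubgroup.mem_bot.2 ((Submodule.Quotient.mk_eq_zero _).2 (h z hz hzj))

/-! ### The Koszul complex on functions of subsets -/

section TotalKoszul

variable (R : Type u) [CommRing R] {l : ℕ}

/-- The sign `(-1)^r` of `s`, where `r` is the number of elements of `σ` below `s`. -/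
def koszulSign (s : Fin l) (σ : Finset (Fin l)) : R := (-1) ^ (σ.filter (· < s)).card

variable {R}

theorem koszulSign_insert {s t : Fin l} {σ : Finset (Fin l)} (h : t ∉ σ) :
    koszulSign R s (insert t σ) = (if t < s then -1 else 1) * koszulSign R s σ := by
  unfold koszulSign
  rw [Finset.filter_insert]
  split_ifs
  · rw [Finset.card_insert_of_notMem (by simp [h]), pow_succ']
  · simp

theorem koszulSign_insert_self (s : Fin l) (σ : Finset (Fin l)) :
    koszulSign R s (insert s σ) = koszulSign R s σ := by
  simp [koszulSign, Finset.filter_insert]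

theorem koszulSign_mul_self (s : Fin l) (σ : Finset (Fin l)) :
    koszulSign R s σ * koszulSign R s σ = 1 := by
  rw [koszulSign, ← pow_add, ← two_mul, pow_mul]
  simp

theorem koszulSign_swap {s t : Fin l} {σ : Finset (Fin l)} (hst : s ≠ t) (hs : s ∉ σ)
    (ht : t ∉ σ) : koszulSign R t σ * koszulSign R s (insert t σ) =
      -(koszulSign R s σ * koszulSign R t (insert s σ)) := by
  rw [koszulSign_insert hs, koszulSign_insert ht]
  rcases lt_or_gt_of_ne hst with h | h
  · simp [h, h.not_gt, mul_comm]
  · simp [h, h.not_gt, mul_comm]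

variable (x : Fin l → R) {M : Type v} [AddCommGroup M] [Module R M]

/-- The Koszul differential on all of `⨁_σ M e_σ`. -/
def totalD : (Finset (Fin l) → M) →ₗ[R] (Finset (Fin l) → M) :=
  LinearMap.pi fun σ => ∑ t ∈ σᶜ, (koszulSign R t σ * x t) • LinearMap.proj (insert t σ)

theorem totalD_apply (c : Finset (Fin l) → M) (σ : Finset (Fin l)) :
    totalD x c σ = ∑ t ∈ σᶜ, (koszulSign R t σ * x t) • c (insert t σ) := by
  simp [totalD]

/-- Inserting s and t in the two possible orders gives opposite signs (`koszulSign_swap`), so the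
terms of the double sum cancel in pairs under (t, s) ↦ (s, t). -/
theorem totalD_totalD (c : Finset (Fin l) → M) : totalD x (totalD x c) = 0 := by
  funext σ
  simp only [totalD_apply, Finset.smul_sum, Pi.zero_apply]
  rw [Finset.sum_sigma']
  refine Finset.sum_involution (fun a _ => ⟨a.2, a.1⟩) ?_ ?_ ?_ ?_
  · rintro ⟨t, s⟩ h
    simp only [Finset.mem_sigma, Finset.mem_compl, Finset.mem_insert, not_or] at h
    obtain ⟨ht, hst, hs⟩ := h
    simp only [smul_smul, Finset.insert_comm s t]
    rw [← add_smul]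
    have := koszulSign_swap (R := R) hst hs ht
    rw [show koszulSign R t σ * x t * (koszulSign R s (insert t σ) * x s) +
      koszulSign R s σ * x s * (koszulSign R t (insert s σ) * x t) =
      (koszulSign R t σ * koszulSign R s (insert t σ) +
        koszulSign R s σ * koszulSign R t (insert s σ)) * (x t * x s) by ring, this]
    simp
  · rintro ⟨t, s⟩ h _ he
    simp only [Finset.mem_sigma, Finset.mem_compl, Finset.mem_insert, not_or] at h
    simp only [Sigma.mk.injEq, heq_eq_eq] at he
    exact h.2.1 he.1
  · rintro ⟨t, s⟩ h
    simp only [Finset.mem_sigma, Finset.mem_compl, Finset.mem_insert, not_or] at h ⊢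
    exact ⟨h.2.2, fun e => h.2.1 e.symm, h.1⟩
  · rintro ⟨t, s⟩ h
    rfl

variable (R) in
/-- Exterior multiplication with the basis element `e_s`. -/
def wedge (s : Fin l) : (Finset (Fin l) → M) →ₗ[R] (Finset (Fin l) → M) :=
  LinearMap.pi fun σ => if s ∈ σ then koszulSign R s σ • LinearMap.proj (σ.erase s) else 0

theorem wedge_apply (s : Fin l) (c : Finset (Fin l) → M) (σ : Finset (Fin l)) :
    wedge R s c σ = if s ∈ σ then koszulSign R s σ • c (σ.erase s) else 0 := by
  simp only [wedge, LinearMap.pi_apply]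
  split_ifs <;> simp

/-- Multiplication by `x s` is null-homotopic on the Koszul complex. -/
theorem totalD_wedge_add (s : Fin l) (c : Finset (Fin l) → M) :
    totalD x (wedge R s c) + wedge R s (totalD x c) = x s • c := by
  funext σ
  simp only [Pi.add_apply, Pi.smul_apply]
  by_cases hs : s ∈ σ
  · obtain ⟨ρ, hρ, rfl⟩ : ∃ ρ, s ∉ ρ ∧ insert s ρ = σ :=
      ⟨σ.erase s, Finset.notMem_erase s σ, Finset.insert_erase hs⟩
    have hc : ρᶜ = insert s (insert s ρ)ᶜ := by
      ext t; by_cases h : t = s <;> simp [h, hρ]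
    rw [wedge_apply, if_pos hs, Finset.erase_insert hρ, totalD_apply, totalD_apply, hc,
      Finset.sum_insert (by simp), smul_add, koszulSign_insert_self, smul_smul, ← mul_assoc,
      koszulSign_mul_self, one_mul, add_comm, add_assoc, add_eq_left, Finset.smul_sum,
      ← Finset.sum_add_distrib]
    refine Finset.sum_eq_zero fun t ht => ?_
    simp only [Finset.mem_compl, Finset.mem_insert, not_or] at ht
    rw [wedge_apply, if_pos (by simp), Finset.insert_comm,
      Finset.erase_insert (by simp [hρ, Ne.symm ht.1]), koszulSign_insert_self, smul_smul,
      smul_smul, ← add_smul]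
    convert! zero_smul R _
    rw [koszulSign_insert (R := R) ht.2, koszulSign_insert (R := R) hρ]
    rcases lt_or_gt_of_ne ht.1 with h | h
    · simp only [h, h.not_gt, if_true, if_false]; ring
    · simp only [h, h.not_gt, if_true, if_false]; ring
  · rw [wedge_apply, if_neg hs, add_zero, totalD_apply, Finset.sum_eq_single s]
    · rw [wedge_apply, if_pos (by simp), Finset.erase_insert hs, koszulSign_insert_self, smul_smul,
        mul_right_comm, koszulSign_mul_self, one_mul]
    · intro t ht hts
      rw [wedge_apply, if_neg (by simp [hs, Ne.symm hts]), smul_zero]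
    · simp [hs]

theorem totalD_comp {N : Type w} [AddCommGroup N] [Module R N] (f : M →ₗ[R] N)
    (c : Finset (Fin l) → M) : totalD x (fun σ => f (c σ)) = fun σ => f (totalD x c σ) := by
  funext σ
  simp [totalD_apply]

/-- The part of a chain in homological degree `k`. -/
def truncChain (k : ℕ) (c : Finset (Fin l) → M) : Finset (Fin l) → M :=
  fun σ => if σ.card = k then c σ else 0

theorem totalD_truncChain (k : ℕ) (c : Finset (Fin l) → M) :
    totalD x (truncChain (k + 1) c) = truncChain k (totalD x c) := by
  funext σ
  simp only [totalD_apply, truncChain]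
  have : ∀ t ∈ σᶜ, ((insert t σ).card = k + 1 ↔ σ.card = k) := fun t ht => by
    rw [Finset.card_insert_of_notMem (by simpa using ht)]; omega
  split_ifs with h
  · exact Finset.sum_congr rfl fun t ht => by rw [if_pos ((this t ht).2 h)]
  · exact Finset.sum_eq_zero fun t ht => by rw [if_neg fun h' => h ((this t ht).1 h'), smul_zero]

theorem truncChain_eq_self {k : ℕ} {c : Finset (Fin l) → M} (h : ∀ σ, σ.card ≠ k → c σ = 0) :
    truncChain k c = c := by
  funext σ
  unfold truncChain
  split_ifs with hk
  · rfl
  · exact (h σ hk).symm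

theorem truncChain_of_ne {k : ℕ} (c : Finset (Fin l) → M) {σ : Finset (Fin l)} (h : σ.card ≠ k) :
    truncChain k c σ = 0 := if_neg h

theorem exists_totalD_eq_of_card {k : ℕ} {c : Finset (Fin l) → M}
    (h : ∀ σ, σ.card ≠ k → c σ = 0) (hb : ∃ b, totalD x b = c) :
    ∃ b, (∀ σ, σ.card ≠ k + 1 → b σ = 0) ∧ totalD x b = c := by
  obtain ⟨b, hb⟩ := hb
  exact ⟨truncChain (k + 1) b, fun σ hσ => truncChain_of_ne b hσ,
    by rw [totalD_truncChain, hb, truncChain_eq_self h]⟩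

/-! #### Acyclicity -/

/-- Each `x t` is a nonzerodivisor modulo any of the other `x s`, in a weak sense. -/
def QuasiRegular (M : Type v) [AddCommGroup M] [Module R M] : Prop :=
  ∀ (U : Finset (Fin l)) (t : Fin l) (b : M), t ∉ U →
    x t • b ∈ Ideal.span (x '' U) • (⊤ : Submodule R M) →
    b ∈ Ideal.span (x '' U) • (⊤ : Submodule R M)

theorem totalD_eq_sum_of_support {U : Finset (Fin l)} {c : Finset (Fin l) → M}
    (hU : ∀ σ, ¬ σ ⊆ U → c σ = 0) :
    totalD x c ∅ ∈ Ideal.span (x '' U) • (⊤ : Submodule R M) := by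
  rw [totalD_apply]
  refine Submodule.sum_mem _ fun t _ => ?_
  by_cases ht : t ∈ U
  · exact Submodule.smul_mem_smul (Ideal.mul_mem_left _ _
      (Ideal.subset_span (Set.mem_image_of_mem x ht))) trivial
  · rw [hU _ (by simpa using ht), smul_zero]
    exact zero_mem _

theorem totalD_single (u : Fin l) (m : M) :
    totalD x (Pi.single {u} m) = Pi.single ∅ (x u • m) := by
  funext σ
  rw [totalD_apply]
  by_cases h : σ = ∅
  · subst h
    rw [Finset.sum_eq_single u]
    · simp [koszulSign]
    · intro t _ ht
      rw [Pi.single_eq_of_ne (by simpa using ht), smul_zero]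
    · simp
  · rw [Pi.single_eq_of_ne h]
    refine Finset.sum_eq_zero fun t ht => ?_
    rw [Pi.single_eq_of_ne, smul_zero]
    intro he
    have hc := congrArg Finset.card he
    rw [Finset.card_insert_of_notMem (by simpa using ht), Finset.card_singleton] at hc
    exact h (Finset.card_eq_zero.1 (by omega))

theorem exists_totalD_eq_single {U : Finset (Fin l)} {m : M}
    (hm : m ∈ Ideal.span (x '' U) • (⊤ : Submodule R M)) :
    ∃ c : Finset (Fin l) → M, (∀ σ, ¬ σ ⊆ U → c σ = 0) ∧ c ∅ = 0 ∧
      totalD x c = Pi.single ∅ m := by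
  have hadd : ∀ m₁ m₂ : M,
      (∃ c : Finset (Fin l) → M, (∀ σ, ¬ σ ⊆ U → c σ = 0) ∧ c ∅ = 0 ∧
        totalD x c = Pi.single ∅ m₁) →
      (∃ c : Finset (Fin l) → M, (∀ σ, ¬ σ ⊆ U → c σ = 0) ∧ c ∅ = 0 ∧
        totalD x c = Pi.single ∅ m₂) →
      ∃ c : Finset (Fin l) → M, (∀ σ, ¬ σ ⊆ U → c σ = 0) ∧ c ∅ = 0 ∧
        totalD x c = Pi.single ∅ (m₁ + m₂) := by
    rintro m₁ m₂ ⟨c₁, h₁, h₁', e₁⟩ ⟨c₂, h₂, h₂', e₂⟩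
    exact ⟨c₁ + c₂, fun σ hσ => by simp [h₁ σ hσ, h₂ σ hσ], by simp [h₁', h₂'],
      by rw [map_add, e₁, e₂, Pi.single_add]⟩
  refine Submodule.smul_induction_on hm (fun r hr m _ => ?_) hadd
  · induction hr using Submodule.span_induction with
    | zero => exact ⟨0, by simp, rfl, by simp⟩
    | add r₁ r₂ _ _ h₁ h₂ => rw [add_smul]; exact hadd _ _ h₁ h₂
    | smul a r _ h =>
      obtain ⟨c, h₁, h₂, e⟩ := h
      refine ⟨a • c, fun σ hσ => by simp [h₁ σ hσ], by simp [h₂], ?_⟩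
      rw [map_smul, e, smul_eq_mul, mul_smul, ← Pi.single_smul]
    | mem r hr =>
      obtain ⟨u, hu, rfl⟩ := hr
      refine ⟨Pi.single {u} m, fun σ hσ => Pi.single_eq_of_ne ?_ _, Pi.single_eq_of_ne ?_ _,
        totalD_single x u m⟩
      · rintro rfl
        exact hσ (by simpa using hu)
      · exact (Finset.singleton_ne_empty u).symm

variable {x} in
-- Induction on the set U of indices in play. Split c = a + e_t ∧ b with a and b free of e_t. Then b
-- is a cycle, and once b = D b' the chain a + x_t b' is a cycle in fewer variables. If it equals D
-- a', then c = D (a' - e_t ∧ b').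
theorem QuasiRegular.exists_totalD_eq (hreg : QuasiRegular x M) (U : Finset (Fin l)) :
    ∀ c : Finset (Fin l) → M, (∀ σ, ¬ σ ⊆ U → c σ = 0) → c ∅ = 0 → totalD x c = 0 →
      ∃ b : Finset (Fin l) → M, (∀ σ, ¬ σ ⊆ U → b σ = 0) ∧ b ∅ = 0 ∧ totalD x b = c := by
  induction U using Finset.induction_on with
  | empty =>
    intro c hc h0 _
    refine ⟨0, by simp, rfl, ?_⟩
    rw [map_zero]
    funext σ
    by_cases h : σ = ∅
    · rw [h, h0]; rfl
    · rw [hc σ (by simpa using h)]; rfl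
  | insert t U ht ih =>
    intro c hc h0 hD
    set a : Finset (Fin l) → M := fun σ => if t ∈ σ then 0 else c σ with ha
    set b : Finset (Fin l) → M :=
      fun σ => if t ∈ σ then 0 else koszulSign R t σ • c (insert t σ) with hb
    have hab : c = a + wedge R t b := by
      funext σ
      rw [Pi.add_apply, wedge_apply]
      by_cases h : t ∈ σ
      · have h1 : koszulSign R t (σ.erase t) = koszulSign R t σ := by
          rw [← koszulSign_insert_self, Finset.insert_erase h]
        simp [ha, hb, h, smul_smul, h1, koszulSign_mul_self, Finset.insert_erase h]
      · simp [ha, h]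
    have hmem : ∀ {e : Finset (Fin l) → M}, (∀ σ, t ∈ σ → e σ = 0) → ∀ σ, t ∈ σ →
        totalD x e σ = 0 := fun he σ hσ => by
      rw [totalD_apply]
      exact Finset.sum_eq_zero fun s _ => by rw [he _ (Finset.mem_insert_of_mem hσ), smul_zero]
    have hat : ∀ σ, t ∈ σ → a σ = 0 := fun σ h => if_pos h
    have hbt : ∀ σ, t ∈ σ → b σ = 0 := fun σ h => if_pos h
    have hDc : totalD x a + x t • b = wedge R t (totalD x b) := by
      have h := totalD_wedge_add x t b
      have h2 : totalD x a + totalD x (wedge R t b) = 0 := by rw [← map_add, ← hab, hD]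
      rw [← h, ← add_assoc, h2, zero_add]
    -- In `hDc` the left side lives on sets without t and the right side on sets containing t, so
    -- both vanish.
    have hDb : totalD x b = 0 := by
      funext σ
      by_cases h : t ∈ σ
      · exact hmem hbt σ h
      · have h1 := congrFun hDc (insert t σ)
        rw [Pi.add_apply, Pi.smul_apply, hmem hat _ (by simp), hbt _ (by simp), smul_zero, add_zero,
          wedge_apply, if_pos (by simp), Finset.erase_insert h] at h1
        have h2 := congrArg (koszulSign R t (insert t σ) • ·) h1
        simpa [smul_smul, koszulSign_mul_self] using h2.symm
    rw [hDb, map_zero] at hDc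
    have haU : ∀ σ, ¬ σ ⊆ U → a σ = 0 := fun σ hσ => by
      by_cases h : t ∈ σ
      · exact if_pos h
      · rw [ha]; simp only [h, if_false]
        exact hc σ fun h' => hσ ((Finset.subset_insert_iff_of_notMem h).1 h')
    have hbU : ∀ σ, ¬ σ ⊆ U → b σ = 0 := fun σ hσ => by
      by_cases h : t ∈ σ
      · exact if_pos h
      · rw [hb]; simp only [h, if_false]
        rw [hc _ fun h' => hσ ?_, smul_zero]
        have := (Finset.insert_subset_iff.1 h').2
        exact (Finset.subset_insert_iff_of_notMem h).1 this
    -- The induction hypothesis needs a chain without component at ∅, so that component of b is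
    -- bounded separately: x_t b(∅) = -(D a)(∅) lies in (x_U) M, and quasi-regularity puts b(∅)
    -- there too.
    obtain ⟨b₀', hb₀U, hb₀0, hb₀D⟩ := exists_totalD_eq_single x (U := U) (m := b ∅)
      (hreg U t _ ht <| by
        have h1 := congrFun hDc ∅
        rw [Pi.add_apply, Pi.smul_apply, Pi.zero_apply] at h1
        rw [eq_neg_of_add_eq_zero_right h1]
        exact neg_mem (totalD_eq_sum_of_support x haU))
    obtain ⟨b₁', hb₁U, hb₁0, hb₁D⟩ := ih (b - Pi.single ∅ (b ∅))
      (fun σ hσ => by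
        rw [Pi.sub_apply, hbU σ hσ, Pi.single_eq_of_ne, sub_zero]
        rintro rfl
        simp at hσ)
      (by simp) (by rw [map_sub, hDb, ← hb₀D, totalD_totalD, sub_zero])
    have hbD : totalD x (b₀' + b₁') = b := by rw [map_add, hb₀D, hb₁D]; abel
    obtain ⟨a', ha'U, ha'0, ha'D⟩ := ih (a + x t • (b₀' + b₁'))
      (fun σ hσ => by simp [haU σ hσ, hb₀U σ hσ, hb₁U σ hσ])
      (by simp [ha, h0, hb₀0, hb₁0])
      (by rw [map_add, map_smul, hbD, hDc])
    refine ⟨a' - wedge R t (b₀' + b₁'), fun σ hσ => ?_, ?_, ?_⟩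
    · have h1 : ¬ σ ⊆ U := fun h => hσ (h.trans (Finset.subset_insert t U))
      have h2 : ¬ σ.erase t ⊆ U := fun h => hσ (Finset.subset_insert_iff.2 h)
      simp [wedge_apply, ha'U σ h1, hb₀U _ h2, hb₁U _ h2]
    · simp [wedge_apply, ha'0]
    · have h1 := totalD_wedge_add x t (b₀' + b₁')
      rw [hbD] at h1
      rw [map_sub, ha'D, hab, ← h1]
      abel

/-! #### Exactness in a given degree -/

variable (d : Fin l → ℕ)

/-- `H_k(x, M)_j = 0`: every homogeneous cycle of degree `j` is a boundary. -/
def ExactAt (𝓜 : ℤ → AddSubgroup M) (k : ℕ) (j : ℤ) : Prop :=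
  ∀ c : Finset (Fin l) → M, (∀ σ, σ.card ≠ k → c σ = 0) →
    (∀ σ, c σ ∈ 𝓜 (j - ∑ s ∈ σ, (d s : ℤ))) → totalD x c = 0 → ∃ b, totalD x b = c

variable {x d} in
-- For the constant family ⊤ the degree condition is void, so `ExactAt` at any index is vanishing of
-- the whole ungraded homology. Degrees such as 0 in such statements are placeholders.
theorem ExactAt.of_top {𝓜 : ℤ → AddSubgroup M} {k : ℕ} {i : ℤ}
    (h : ExactAt x d (fun _ => (⊤ : AddSubgroup M)) k i) (j : ℤ) : ExactAt x d 𝓜 k j :=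
  fun c hc _ hD => h c hc (fun _ => trivial) hD

variable {x} in
theorem QuasiRegular.exactAt (hreg : QuasiRegular x M) (𝓜 : ℤ → AddSubgroup M) (k : ℕ) (j : ℤ) :
    ExactAt x d 𝓜 (k + 1) j := fun c hc _ hD => by
  obtain ⟨b, _, _, h⟩ := hreg.exists_totalD_eq Finset.univ c (fun σ hσ => by simp at hσ)
    (hc ∅ (by simp)) hD
  exact ⟨b, h⟩

theorem map_mem_smul_top {N : Type w} [AddCommGroup N] [Module R N] (f : M →ₗ[R] N)
    {J : Ideal R} {m : M} (hm : m ∈ J • (⊤ : Submodule R M)) :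
    f m ∈ J • (⊤ : Submodule R N) := by
  have := Submodule.mem_map_of_mem (f := f) hm
  rw [Submodule.map_smul''] at this
  exact Submodule.smul_mono le_rfl le_top this

theorem QuasiRegular.of_retract {N : Type w} [AddCommGroup N] [Module R N] {x : Fin l → R}
    (hreg : QuasiRegular x N) (i : M →ₗ[R] N) (r : N →ₗ[R] M) (hri : ∀ m, r (i m) = m) :
    QuasiRegular x M := by
  intro U t b ht hb
  have h1 := map_mem_smul_top i hb
  rw [map_smul] at h1
  simpa only [hri] using map_mem_smul_top r (hreg U t _ ht h1)

/-- The bridge between the complex indexed by sets of a fixed size and the one on all subsets, where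
no cardinality proofs are needed. -/
theorem koszulD_restrict (k : ℕ) (b : Finset (Fin l) → M)
    (σ : {σ : Finset (Fin l) // σ.card = k}) :
    koszulD x M k (fun τ => b τ.1) σ = totalD x b σ.1 := by
  rw [totalD_apply]
  simp only [koszulD, LinearMap.pi_apply, LinearMap.sum_apply, LinearMap.smul_apply,
    LinearMap.proj_apply]
  exact (Finset.sum_subtype (p := fun t => t ∉ σ.1) σ.1ᶜ (by simp)
    (fun t => (koszulSign R t σ.1 * x t) • b (insert t σ.1))).symm

/-- The extension by zero of a chain concentrated in homological degree `k`. -/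
def extendChain {k : ℕ} (z : KoszulChain l M k) : Finset (Fin l) → M :=
  fun σ => if h : σ.card = k then z ⟨σ, h⟩ else 0

theorem extendChain_coe {k : ℕ} (z : KoszulChain l M k) (σ : {σ : Finset (Fin l) // σ.card = k}) :
    extendChain z σ.1 = z σ := dif_pos σ.2

theorem extendChain_of_ne {k : ℕ} (z : KoszulChain l M k) {σ : Finset (Fin l)}
    (hσ : σ.card ≠ k) : extendChain z σ = 0 := dif_neg hσ

theorem extendChain_smul {k : ℕ} (a : R) (z : KoszulChain l M k) :
    extendChain (a • z) = a • extendChain z := by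
  funext σ
  rw [Pi.smul_apply]
  by_cases hσ : σ.card = k
  · exact (extendChain_coe _ ⟨σ, hσ⟩).trans (congrArg (a • ·) (extendChain_coe z ⟨σ, hσ⟩)).symm
  · rw [extendChain_of_ne _ hσ, extendChain_of_ne _ hσ, smul_zero]

theorem totalD_extendChain {k : ℕ} {z : KoszulChain l M k} (hz : z ∈ koszulCycles x M k) :
    totalD x (extendChain z) = 0 := by
  funext σ
  rw [Pi.zero_apply]
  by_cases hσ : σ.card + 1 = k
  · subst hσ
    rw [← koszulD_restrict x _ _ ⟨σ, rfl⟩, show (fun τ : {τ : Finset (Fin l) //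
      τ.card = σ.card + 1} => extendChain z τ.1) = z from funext (extendChain_coe z)]
    exact congrFun (LinearMap.mem_ker.1 hz) ⟨σ, rfl⟩
  · rw [totalD_apply]
    refine Finset.sum_eq_zero fun t ht => ?_
    rw [extendChain_of_ne _ (by rwa [Finset.card_insert_of_notMem (by simpa using ht)]), smul_zero]

theorem mem_range_koszulD {k : ℕ} {z : KoszulChain l M k}
    (h : ∃ b, totalD x b = extendChain z) : z ∈ LinearMap.range (koszulD x M k) := by
  obtain ⟨b, hb⟩ := h
  exact ⟨fun τ => b τ.1, funext fun σ => by rw [koszulD_restrict, hb, extendChain_coe]⟩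

/-- The Koszul homology vanishes in degree `j` if all homogeneous cycles of degree `j` are
boundaries. -/
theorem koszulHomologyPart_eq_bot {𝓜 : ℤ → AddSubgroup M} {k : ℕ} {j : ℤ}
    (h : ExactAt x d 𝓜 k j) : koszulHomologyPart x d 𝓜 k j = ⊥ := by
  rw [koszulHomologyPart, subQuotPart_eq_bot_iff]
  intro z hz hzj
  change ∀ σ : {σ : Finset (Fin l) // σ.card = k}, z σ ∈ 𝓜 (j - ∑ s ∈ σ.1, (d s : ℤ)) at hzj
  refine mem_range_koszulD x (h _ (fun σ hσ => extendChain_of_ne z hσ) (fun σ => ?_)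
    (totalD_extendChain x hz))
  by_cases hσ : σ.card = k
  · exact (extendChain_coe z ⟨σ, hσ⟩).symm ▸ hzj ⟨σ, hσ⟩
  · rw [extendChain_of_ne z hσ]
    exact zero_mem _

/-- The elements of the ideal of the sequence annihilate Koszul homology. -/
theorem exists_totalD_eq_smul {a : R} (ha : a ∈ Ideal.span (Set.range x))
    {c : Finset (Fin l) → M} (hc : totalD x c = 0) : ∃ b, totalD x b = a • c := by
  induction ha using Submodule.span_induction with
  | zero => exact ⟨0, by simp⟩
  | add r₁ r₂ _ _ h₁ h₂ =>
    obtain ⟨b₁, h₁⟩ := h₁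
    obtain ⟨b₂, h₂⟩ := h₂
    exact ⟨b₁ + b₂, by rw [map_add, h₁, h₂, add_smul]⟩
  | smul r a _ h =>
    obtain ⟨b, h⟩ := h
    exact ⟨r • b, by rw [map_smul, h, smul_smul, smul_eq_mul]⟩
  | mem a h =>
    obtain ⟨s, rfl⟩ := h
    exact ⟨wedge R s c, by simpa [hc] using totalD_wedge_add x s c⟩

/-- The elements of `(x) + Ann M` annihilate Koszul homology. -/
theorem exists_totalD_eq_smul_of_mem_sup {a : R}
    (ha : a ∈ Ideal.span (Set.range x) ⊔ Module.annihilator R M)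
    {c : Finset (Fin l) → M} (hc : totalD x c = 0) : ∃ b, totalD x b = a • c := by
  obtain ⟨a₁, h₁, a₂, h₂, rfl⟩ := Submodule.mem_sup.1 ha
  obtain ⟨b, hb⟩ := exists_totalD_eq_smul x h₁ hc
  refine ⟨b, hb.trans ?_⟩
  funext σ
  simp [add_smul, Module.mem_annihilator.1 h₂ (c σ)]

theorem smul_koszulHomology_eq_zero {a : R}
    (ha : a ∈ Ideal.span (Set.range x) ⊔ Module.annihilator R M) {k : ℕ}
    (h : KoszulHomology x M k) : a • h = 0 := by
  obtain ⟨⟨z, hz⟩, rfl⟩ := Submodule.mkQ_surjective _ h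
  rw [← map_smul]
  refine (Submodule.Quotient.mk_eq_zero _).2 (mem_range_koszulD x ?_)
  obtain ⟨b, hb⟩ := exists_totalD_eq_smul_of_mem_sup x ha (totalD_extendChain x hz)
  exact ⟨b, hb.trans (extendChain_smul a z).symm⟩

variable {x d}

theorem totalD_mem {𝓜 : ℤ → AddSubgroup M}
    (hx : ∀ t i m, m ∈ 𝓜 i → x t • m ∈ 𝓜 (i + d t)) {c : Finset (Fin l) → M} {j : ℤ}
    (hc : ∀ σ, c σ ∈ 𝓜 (j - ∑ s ∈ σ, (d s : ℤ))) (σ : Finset (Fin l)) :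
    totalD x c σ ∈ 𝓜 (j - ∑ s ∈ σ, (d s : ℤ)) := by
  rw [totalD_apply]
  refine sum_mem fun t ht => ?_
  have h := hx t _ _ (hc (insert t σ))
  rw [Finset.sum_insert (by simpa using ht),
    show j - ((d t : ℤ) + ∑ s ∈ σ, (d s : ℤ)) + d t = j - ∑ s ∈ σ, (d s : ℤ) by ring] at h
  rw [mul_smul, koszulSign]
  rcases neg_one_pow_eq_or R (σ.filter (· < t)).card with e | e
  · rwa [e, one_smul]
  · rw [e, neg_one_smul]
    exact neg_mem h

/-- Dimension shifting along `0 → ker π → F → N → 0` with `F` acyclic. -/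
theorem ExactAt.shift {F : Type v} [AddCommGroup F] [Module R F] {N : Type w} [AddCommGroup N]
    [Module R N] (π : F →ₗ[R] N) {𝓕 : ℤ → AddSubgroup F} {𝓝 : ℤ → AddSubgroup N}
    (hx : ∀ t i m, m ∈ 𝓕 i → x t • m ∈ 𝓕 (i + d t))
    (hlift : ∀ i, ∀ m ∈ 𝓝 i, ∃ f ∈ 𝓕 i, π f = m) (hF : QuasiRegular x F) {k : ℕ} {j : ℤ}
    (H : ∀ c : Finset (Fin l) → LinearMap.ker π, (∀ σ, σ.card ≠ k → c σ = 0) →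
      (∀ σ, (c σ : F) ∈ 𝓕 (j - ∑ s ∈ σ, (d s : ℤ))) →
      (∃ b : Finset (Fin l) → F, totalD x b = fun σ => (c σ : F)) → ∃ b, totalD x b = c) :
    ExactAt x d 𝓝 (k + 1) j := by
  intro c hck hcj hD
  choose f hf hπf using fun σ => hlift _ _ (hcj σ)
  set c' : Finset (Fin l) → F := truncChain (k + 1) f with hc'
  have hc'j : ∀ σ, c' σ ∈ 𝓕 (j - ∑ s ∈ σ, (d s : ℤ)) := fun σ => by
    rw [hc', truncChain]; split_ifs
    exacts [hf σ, zero_mem _]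
  have hπc' : (fun σ => π (c' σ)) = c := by
    funext σ
    rw [hc', truncChain]; split_ifs with h
    exacts [hπf σ, by rw [map_zero, hck σ h]]
  have hker : ∀ σ, totalD x c' σ ∈ LinearMap.ker π := fun σ => by
    have := congrFun (totalD_comp x π c') σ
    rw [LinearMap.mem_ker, ← this, hπc', hD, Pi.zero_apply]
  obtain ⟨b, hbk, hb⟩ := exists_totalD_eq_of_card x (k := k) (c := fun σ => ⟨totalD x c' σ, hker σ⟩)
    (fun σ hσ => Subtype.ext (by
      change totalD x c' σ = 0
      rw [hc', totalD_truncChain, truncChain_of_ne _ hσ]))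
    (H _ (fun σ hσ => Subtype.ext (by
      change totalD x c' σ = 0
      rw [hc', totalD_truncChain, truncChain_of_ne _ hσ])) (totalD_mem hx hc'j) ⟨c', rfl⟩)
  have hb' : totalD x (fun σ => (b σ : F)) = totalD x c' := by
    have := totalD_comp x (LinearMap.ker π).subtype b
    rw [hb] at this
    exact this
  -- The lift c' of c and the chain b in the kernel have the same boundary, so c' - b bounds in the
  -- acyclic complex of F; applying π removes b.
  obtain ⟨v, hv⟩ := hF.exactAt (d := d) (fun _ => ⊤) k 0 (c' - fun σ => (b σ : F))
    (fun σ hσ => by simp [hc', truncChain_of_ne _ hσ, hbk σ hσ]) (fun _ => trivial)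
    (by rw [map_sub, hb', sub_self])
  refine ⟨fun σ => π (v σ), ?_⟩
  rw [totalD_comp, hv, ← hπc']
  funext σ
  simp

/-- Koszul homology of `M' = M / yM` for an `M`-regular element `y` of degree `e`. -/
theorem ExactAt.quotient {M' : Type w} [AddCommGroup M'] [Module R M'] (π : M →ₗ[R] M')
    {𝓜 : ℤ → AddSubgroup M} {𝓜' : ℤ → AddSubgroup M'} {y : R} {e : ℤ} (hy : IsSMulRegular M y)
    (hx : ∀ t i m, m ∈ 𝓜 i → x t • m ∈ 𝓜 (i + d t))
    (hπ : ∀ m, π m = 0 ↔ ∃ b, y • b = m) (hlift : ∀ i, ∀ m ∈ 𝓜' i, ∃ f ∈ 𝓜 i, π f = m)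
    (hhom : ∀ i m, y • m ∈ 𝓜 i → m ∈ 𝓜 (i - e)) {k : ℕ} {i j : ℤ}
    (h₁ : ExactAt x d (fun _ => (⊤ : AddSubgroup M)) (k + 1) i) (h₂ : ExactAt x d 𝓜 k (j - e)) :
    ExactAt x d 𝓜' (k + 1) j := by
  intro c hck hcj hD
  choose f hf hπf using fun σ => hlift _ _ (hcj σ)
  set c' : Finset (Fin l) → M := truncChain (k + 1) f with hc'
  have hc'j : ∀ σ, c' σ ∈ 𝓜 (j - ∑ s ∈ σ, (d s : ℤ)) := fun σ => by
    rw [hc', truncChain]; split_ifs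
    exacts [hf σ, zero_mem _]
  have hπc' : (fun σ => π (c' σ)) = c := by
    funext σ
    rw [hc', truncChain]; split_ifs with h
    exacts [hπf σ, by rw [map_zero, hck σ h]]
  have hker : ∀ σ, ∃ b, y • b = totalD x c' σ := fun σ => by
    have := congrFun (totalD_comp x π c') σ
    rw [← hπ, ← this, hπc', hD, Pi.zero_apply]
  choose b hb using hker
  have hyb : y • b = totalD x c' := funext hb
  obtain ⟨b₂, hb₂k, hb₂⟩ := exists_totalD_eq_of_card x (k := k) (c := b)
    (fun σ hσ => hy (by
      change y • b σ = y • 0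
      rw [hb, hc', totalD_truncChain, truncChain_of_ne _ hσ, smul_zero]))
    (h₂ b (fun σ hσ => hy (by
      change y • b σ = y • 0
      rw [hb, hc', totalD_truncChain, truncChain_of_ne _ hσ, smul_zero])) (fun σ => by
        have := hhom _ (b σ) (by rw [hb]; exact totalD_mem hx hc'j σ)
        rwa [sub_right_comm] at this)
      (funext fun σ => hy (by
        change y • totalD x b σ = y • 0
        rw [← Pi.smul_apply, ← map_smul, hyb, totalD_totalD, Pi.zero_apply, smul_zero])))
  -- The connecting map sends the class of c to that of b = (D c')/y, which bounds b₂. Since b₂ was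
  -- not chosen homogeneous, neither is c' - y b₂ known to be; this is why `h₁` is the ungraded
  -- vanishing.
  obtain ⟨v, hv⟩ := h₁ (c' - y • b₂)
    (fun σ hσ => by simp [hc', truncChain_of_ne _ hσ, hb₂k σ hσ]) (fun _ => trivial)
    (by rw [map_sub, map_smul, hb₂, hyb, sub_self])
  refine ⟨fun σ => π (v σ), ?_⟩
  rw [totalD_comp, hv, ← hπc']
  funext σ
  have := (hπ (y • b₂ σ)).2 ⟨_, rfl⟩
  rw [Pi.sub_apply, map_sub, Pi.smul_apply, this, sub_zero]

/-- If `y` is `M`-regular of degree `e` and annihilates the Koszul homology of `M`, then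
`H_k(x, M)_j` embeds into `H_{k+1}(x, M / yM)_{j+e}`. -/
theorem ExactAt.of_quotient {M' : Type w} [AddCommGroup M'] [Module R M'] (π : M →ₗ[R] M')
    {𝓜 : ℤ → AddSubgroup M} {𝓜' : ℤ → AddSubgroup M'} {y : R} {e : ℤ} (hy : IsSMulRegular M y)
    (hπ : ∀ m, π m = 0 ↔ ∃ b, y • b = m) (hsurj : Function.Surjective π)
    (hπ' : ∀ i, ∀ m ∈ 𝓜 i, π m ∈ 𝓜' i) (hhom : ∀ i, ∀ m ∈ 𝓜 i, y • m ∈ 𝓜 (i + e))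
    (hkill : ∀ c : Finset (Fin l) → M, totalD x c = 0 → ∃ b, totalD x b = y • c)
    (hpre : ∀ (c : Finset (Fin l) → M) (i : ℤ), (∀ σ, c σ ∈ 𝓜 (i - ∑ s ∈ σ, (d s : ℤ))) →
      (∃ b, totalD x b = c) →
      ∃ b, (∀ σ, b σ ∈ 𝓜 (i - ∑ s ∈ σ, (d s : ℤ))) ∧ totalD x b = c)
    {k : ℕ} {j : ℤ} (h : ExactAt x d 𝓜' (k + 1) (j + e)) : ExactAt x d 𝓜 k j := by
  intro c hck hcj hD
  -- A homogeneous chain bounded by y c: only for such a chain can the vanishing over M' in degree j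
  -- + e be applied to its reduction modulo y.
  obtain ⟨b₀, hb₀j, hb₀⟩ := hpre (y • c) (j + e)
    (fun σ => by have := hhom _ _ (hcj σ); rwa [sub_add_eq_add_sub] at this) (hkill c hD)
  set b : Finset (Fin l) → M := truncChain (k + 1) b₀ with hb
  have hbD : totalD x b = y • c := by
    rw [hb, totalD_truncChain, hb₀, truncChain_eq_self fun σ hσ => by
      rw [Pi.smul_apply, hck σ hσ, smul_zero]]
  obtain ⟨u', hu'⟩ := h (fun σ => π (b σ)) (fun σ hσ => by rw [hb, truncChain_of_ne _ hσ, map_zero])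
    (fun σ => hπ' _ _ (by
      rw [hb, truncChain]; split_ifs
      exacts [hb₀j σ, zero_mem _]))
    (by
      rw [totalD_comp, hbD]
      exact funext fun σ => (hπ _).2 ⟨_, rfl⟩)
  choose u hu using fun σ => hsurj (u' σ)
  have hker : ∀ σ, ∃ b', y • b' = (b - totalD x u) σ := fun σ => by
    rw [← hπ, Pi.sub_apply, map_sub]
    have h1 := congrFun (totalD_comp x π u) σ
    simp only [hu] at h1
    rw [← h1]
    exact sub_eq_zero.2 (congrFun hu' σ).symm
  choose b' hb' using hker
  -- From y b' = b - D u follows y D b' = D b = y c, and y cancels.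
  refine ⟨b', funext fun σ => hy ?_⟩
  change y • totalD x b' σ = y • c σ
  rw [← Pi.smul_apply, ← map_smul, show y • b' = b - totalD x u from funext hb', map_sub,
    totalD_totalD, sub_zero, hbD, Pi.smul_apply]

end TotalKoszul

end KoszulReg

namespace KoszulReg

/-! ### Gradings with explicit projections -/

/-- A grading of a module together with the projections to the homogeneous components. -/
structure Grading {R : Type u} [CommRing R] (𝓡 : ℤ → AddSubgroup R) {M : Type v} [AddCommGroup M]
    [Module R M] (𝓜 : ℤ → AddSubgroup M) where
  /-- The projection to the component of degree `j`. -/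
  proj : ℤ → M →+ M
  proj_mem : ∀ j m, proj j m ∈ 𝓜 j
  proj_self : ∀ {j m}, m ∈ 𝓜 j → proj j m = m
  proj_ne : ∀ {i j m}, m ∈ 𝓜 i → i ≠ j → proj j m = 0
  mem_iSup : ∀ m, m ∈ ⨆ j, 𝓜 j
  smul_mem : ∀ {i j p m}, p ∈ 𝓡 i → m ∈ 𝓜 j → p • m ∈ 𝓜 (i + j)

namespace Grading

variable {R : Type u} [CommRing R] {𝓡 : ℤ → AddSubgroup R} {M : Type v} [AddCommGroup M]
  [Module R M] {𝓜 : ℤ → AddSubgroup M}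

/-- The grading with projections underlying a graded module. -/
noncomputable def ofIsGradedModule (h : IsGradedModule 𝓡 𝓜) : Grading 𝓡 𝓜 :=
  letI := h.isInternal.chooseDecomposition
  { proj := fun j => AddMonoidHom.mk' (fun m => (DirectSum.decompose 𝓜 m j : M)) fun a b => by
      simp [DirectSum.decompose_add]
    proj_mem := fun j m => (DirectSum.decompose 𝓜 m j).2
    proj_self := fun hm => DirectSum.decompose_of_mem_same 𝓜 hm
    proj_ne := fun hm hij => DirectSum.decompose_of_mem_ne 𝓜 hm hij
    mem_iSup := fun m => by
      classical
      rw [← DirectSum.sum_support_decompose 𝓜 m]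
      exact sum_mem fun i _ => AddSubgroup.mem_iSup_of_mem i (DirectSum.decompose 𝓜 m i).2
    smul_mem := fun hp hm => h.smul_mem _ _ _ _ hp hm }

variable (G : Grading 𝓡 𝓜)

include G

theorem induction {motive : M → Prop} (m : M) (mem : ∀ i, ∀ m ∈ 𝓜 i, motive m)
    (add : ∀ a b, motive a → motive b → motive (a + b)) : motive m :=
  AddSubgroup.iSup_induction (C := motive) 𝓜 (G.mem_iSup m) mem (mem 0 0 (zero_mem _)) add

theorem exists_sum (m : M) : ∃ s : Finset ℤ, m = ∑ j ∈ s, G.proj j m := by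
  classical
  suffices ∃ s : Finset ℤ, ∀ t, s ⊆ t → m = ∑ j ∈ t, G.proj j m by
    obtain ⟨s, hs⟩ := this
    exact ⟨s, hs s subset_rfl⟩
  induction m using G.induction with
  | mem i m hm =>
    refine ⟨{i}, fun t ht => ?_⟩
    rw [Finset.sum_eq_single i (fun j _ hj => G.proj_ne hm hj.symm)
      (fun h => (h (ht (by simp))).elim), G.proj_self hm]
  | add a b ha hb =>
    obtain ⟨s, hs⟩ := ha
    obtain ⟨t, ht⟩ := hb
    refine ⟨s ∪ t, fun r hr => ?_⟩
    simp only [map_add, Finset.sum_add_distrib]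
    rw [← hs r (Finset.union_subset_left hr), ← ht r (Finset.union_subset_right hr)]

theorem proj_smul {i : ℤ} {r : R} (hr : r ∈ 𝓡 i) (m : M) (j : ℤ) :
    G.proj j (r • m) = r • G.proj (j - i) m := by
  induction m using G.induction with
  | mem k m hm =>
    have h := G.smul_mem hr hm
    by_cases hk : i + k = j
    · subst hk
      rw [G.proj_self h, add_sub_cancel_left, G.proj_self hm]
    · rw [G.proj_ne h hk, G.proj_ne hm (by omega), smul_zero]
  | add a b ha hb => rw [smul_add, map_add, ha, hb, map_add, smul_add]

theorem proj_smul_of_mem (GR : Grading 𝓡 𝓡) {i : ℤ} {m : M} (hm : m ∈ 𝓜 i) (r : R) (j : ℤ) :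
    G.proj j (r • m) = GR.proj (j - i) r • m := by
  induction r using GR.induction with
  | mem k r hr =>
    have h := G.smul_mem hr hm
    by_cases hk : k + i = j
    · subst hk
      rw [G.proj_self h, add_sub_cancel_right, GR.proj_self hr]
    · rw [G.proj_ne h hk, GR.proj_ne hr (by omega), zero_smul]
  | add a b ha hb => rw [add_smul, map_add, ha, hb, map_add, add_smul]

theorem mem_of_smul_mem {y : R} {e : ℤ} (hye : y ∈ 𝓡 e) (hy : IsSMulRegular M y) (i : ℤ) (m : M)
    (h : y • m ∈ 𝓜 i) : m ∈ 𝓜 (i - e) := by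
  have h1 := G.proj_self h
  rw [G.proj_smul hye] at h1
  rw [← hy h1]
  exact G.proj_mem _ _

/-- The grading of a quotient by a submodule which is stable under the projections. -/
def quotient (B : Submodule R M) (hB : ∀ j, ∀ m ∈ B, G.proj j m ∈ B) :
    Grading 𝓡 (M := M ⧸ B) (fun j => (𝓜 j).map B.mkQ.toAddMonoidHom) where
  proj j := QuotientAddGroup.map B.toAddSubgroup B.toAddSubgroup (G.proj j) (hB j)
  proj_mem j m := by
    obtain ⟨m, rfl⟩ := B.mkQ_surjective m
    exact ⟨_, G.proj_mem j m, rfl⟩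
  proj_self := by
    rintro j _ ⟨m, hm, rfl⟩
    exact congrArg B.mkQ (G.proj_self hm)
  proj_ne := by
    rintro i j _ ⟨m, hm, rfl⟩ hij
    exact (congrArg B.mkQ (G.proj_ne hm hij)).trans (map_zero _)
  mem_iSup m := by
    obtain ⟨m, rfl⟩ := B.mkQ_surjective m
    rw [← AddSubgroup.map_iSup]
    exact ⟨m, G.mem_iSup m, rfl⟩
  smul_mem := by
    rintro i j p _ hp ⟨m, hm, rfl⟩
    exact ⟨_, G.smul_mem hp hm, rfl⟩

theorem proj_mem_smul_top {ι : Type*} {x : ι → R} {e : ι → ℤ} (hx : ∀ i, x i ∈ 𝓡 (e i)) (j : ℤ)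
    {m : M} (hm : m ∈ Ideal.span (Set.range x) • (⊤ : Submodule R M)) :
    G.proj j m ∈ Ideal.span (Set.range x) • (⊤ : Submodule R M) := by
  refine Submodule.smul_induction_on hm (fun r hr m _ => ?_)
    (fun a b ha hb => by rw [map_add]; exact add_mem ha hb)
  induction hr using Submodule.span_induction generalizing m with
  | zero => simp
  | add r₁ r₂ _ _ h₁ h₂ => rw [add_smul, map_add]; exact add_mem (h₁ m trivial) (h₂ m trivial)
  | smul a r _ h => rw [smul_eq_mul, mul_comm, mul_smul]; exact h _ trivial
  | mem r h =>
    obtain ⟨i, rfl⟩ := h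
    rw [G.proj_smul (hx i)]
    exact Submodule.smul_mem_smul (Ideal.subset_span ⟨i, rfl⟩) trivial

/-- The differential is homogeneous, so a bounding chain may be replaced by its component of the
right degree. -/
theorem exists_homogeneous_totalD_eq {l : ℕ} {x : Fin l → R} {d : Fin l → ℕ}
    (hx : ∀ t, x t ∈ 𝓡 (d t)) (c : Finset (Fin l) → M) (i : ℤ)
    (hc : ∀ σ, c σ ∈ 𝓜 (i - ∑ s ∈ σ, (d s : ℤ))) (h : ∃ b, totalD x b = c) :
    ∃ b, (∀ σ, b σ ∈ 𝓜 (i - ∑ s ∈ σ, (d s : ℤ))) ∧ totalD x b = c := by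
  obtain ⟨b, rfl⟩ := h
  refine ⟨fun σ => G.proj (i - ∑ s ∈ σ, (d s : ℤ)) (b σ), fun σ => G.proj_mem _ _, ?_⟩
  funext σ
  rw [← G.proj_self (hc σ), totalD_apply, totalD_apply, map_sum]
  refine Finset.sum_congr rfl fun t ht => ?_
  rw [mul_smul, mul_smul, Finset.sum_insert (by simpa using ht), sub_add_eq_sub_sub_swap,
    ← G.proj_smul (hx t), koszulSign]
  rcases neg_one_pow_eq_or R (σ.filter (· < t)).card with e | e
  · rw [e, one_smul, one_smul]
  · rw [e, neg_one_smul, neg_one_smul, map_neg]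

theorem smul_mem' {l : ℕ} {x : Fin l → R} {d : Fin l → ℕ} (hx : ∀ t, x t ∈ 𝓡 (d t)) (t : Fin l)
    (i : ℤ) (m : M) (hm : m ∈ 𝓜 i) : x t • m ∈ 𝓜 (i + d t) := by
  rw [add_comm]
  exact G.smul_mem (hx t) hm

end Grading

/-! ### The polynomial ring -/

section Poly

variable {n : ℕ} {K : Type u} [Field K]

theorem mem_polyPart_natCast {p : Poly n K} {e : ℕ} :
    p ∈ polyPart n K (e : ℤ) ↔ p.IsHomogeneous e := by
  simp [polyPart, MvPolynomial.mem_homogeneousSubmodule]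

theorem polyPart_of_neg {e : ℤ} (he : e < 0) : polyPart n K e = ⊥ := by
  simp [polyPart, he.not_ge]

theorem one_mem_polyPart : (1 : Poly n K) ∈ polyPart n K 0 := by
  have := mem_polyPart_natCast (n := n) (K := K) (e := 0) (p := 1)
  exact this.2 (MvPolynomial.isHomogeneous_one _ _)

variable (n K) in
/-- The standard grading of the polynomial ring. -/
noncomputable def polyGrading : Grading (polyPart n K) (polyPart n K) where
  proj j := if 0 ≤ j then (MvPolynomial.homogeneousComponent j.toNat).toAddMonoidHom else 0
  proj_mem j p := by
    split_ifs with h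
    · lift j to ℕ using h
      exact mem_polyPart_natCast.2 (MvPolynomial.homogeneousComponent_isHomogeneous _ _)
    · exact zero_mem _
  proj_self {j p} hp := by
    split_ifs with h
    · lift j to ℕ using h
      exact MvPolynomial.homogeneousComponent_eq_self (mem_polyPart_natCast.1 hp)
    · rw [polyPart_of_neg (not_le.1 h), AddSubgroup.mem_bot] at hp
      rw [hp, map_zero]
  proj_ne {i j p} hp hij := by
    split_ifs with h
    · lift j to ℕ using h
      rcases lt_or_ge i 0 with hi | hi
      · rw [polyPart_of_neg hi, AddSubgroup.mem_bot] at hp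
        rw [hp, map_zero]
      · lift i to ℕ using hi
        refine (MvPolynomial.homogeneousComponent_of_mem
          ((MvPolynomial.mem_homogeneousSubmodule _ _).2 (mem_polyPart_natCast.1 hp))).trans ?_
        rw [if_neg]
        rintro h
        simp at h
        omega
    · rfl
  mem_iSup p := by
    rw [← MvPolynomial.sum_homogeneousComponent p]
    exact sum_mem fun i _ => AddSubgroup.mem_iSup_of_mem (i : ℤ)
      (mem_polyPart_natCast.2 (MvPolynomial.homogeneousComponent_isHomogeneous _ _))
  smul_mem {i j p m} hp hm := by
    rcases lt_or_ge i 0 with hi | hi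
    · rw [polyPart_of_neg hi, AddSubgroup.mem_bot] at hp
      rw [hp, zero_smul]
      exact zero_mem _
    rcases lt_or_ge j 0 with hj | hj
    · rw [polyPart_of_neg hj, AddSubgroup.mem_bot] at hm
      rw [hm, smul_zero]
      exact zero_mem _
    lift i to ℕ using hi
    lift j to ℕ using hj
    rw [mem_polyPart_natCast] at hp hm
    exact_mod_cast mem_polyPart_natCast.2 (hp.mul hm)

theorem X_mem_polyPart (s : Fin n) : (MvPolynomial.X s : Poly n K) ∈ polyPart n K ((1 : ℕ) : ℤ) :=
  mem_polyPart_natCast.2 (MvPolynomial.isHomogeneous_X K s)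

/-- Membership in an ideal generated by variables is read off the exponents of each monomial, and
multiplication by X_t does not change the exponents of the variables in U. -/
theorem quasiRegular_X :
    QuasiRegular (MvPolynomial.X : Fin n → Poly n K) (Poly n K) := by
  intro U t b ht hb
  rw [smul_eq_mul, Ideal.mul_top] at hb ⊢
  rw [MvPolynomial.mem_ideal_span_X_image] at hb ⊢
  intro m hm
  obtain ⟨i, hi, h⟩ := hb (Finsupp.single t 1 + m) (by
    rw [smul_eq_mul, MvPolynomial.mem_support_iff, MvPolynomial.coeff_X_mul]
    exact MvPolynomial.mem_support_iff.1 hm)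
  refine ⟨i, hi, ?_⟩
  have hit : t ≠ i := fun e => ht (e ▸ hi)
  simpa [Finsupp.single_apply, hit] using h

end Poly

theorem QuasiRegular.finsupp {R : Type u} [CommRing R] {l : ℕ} {x : Fin l → R}
    (h : QuasiRegular x R) (ι : Type v) : QuasiRegular x (ι →₀ R) := by
  have key : ∀ (J : Ideal R) (f : ι →₀ R),
      f ∈ J • (⊤ : Submodule R (ι →₀ R)) ↔ ∀ i, f i ∈ J • (⊤ : Submodule R R) := by
    intro J f
    refine ⟨fun hf i => map_mem_smul_top (Finsupp.lapply i) hf, fun hf => ?_⟩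
    rw [← Finsupp.sum_single f]
    exact sum_mem fun i _ => map_mem_smul_top (Finsupp.lsingle i) (hf i)
  intro U t b ht hb
  rw [key] at hb ⊢
  exact fun i => h U t _ ht (by simpa using hb i)

/-! ### Gradings on the canonical free resolution -/

namespace GrMod

variable {R : Type u} [CommRing R] {𝓡 : ℤ → AddSubgroup R} (GR : Grading 𝓡 𝓡) {N : GrMod R}

/-- The grading of the free module `F(N)`. -/
noncomputable def freeGrading (N : GrMod R) : Grading 𝓡 (N.freePart 𝓡) :=
  have key : ∀ (j : ℤ) (f : N.Free) (b : Σ j : ℤ, N.part j),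
      Finsupp.liftAddHom (fun b : Σ j : ℤ, N.part j =>
        (Finsupp.singleAddHom b).comp (GR.proj (j - b.1))) f b = GR.proj (j - b.1) (f b) := by
    classical
    intro j f b
    induction f using Finsupp.induction_linear with
    | zero => simp
    | add f g hf hg => rw [map_add, Finsupp.add_apply, hf, hg, Finsupp.add_apply, map_add]
    | single a r =>
      rw [Finsupp.liftAddHom_apply_single, AddMonoidHom.comp_apply, Finsupp.singleAddHom_apply,
        Finsupp.single_apply, Finsupp.single_apply]
      split_ifs with h
      · rw [h]
      · rw [map_zero]
  { proj := fun j => Finsupp.liftAddHom fun b : Σ j : ℤ, N.part j =>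
      (Finsupp.singleAddHom b).comp (GR.proj (j - b.1))
    proj_mem := fun j f b => by rw [key]; exact GR.proj_mem _ _
    proj_self := fun {j f} hf => Finsupp.ext fun b => by rw [key]; exact GR.proj_self (hf b)
    proj_ne := fun {i j f} hf hij => Finsupp.ext fun b => by
      rw [key]; exact GR.proj_ne (hf b) (by omega)
    mem_iSup := fun f => by
      classical
      induction f using Finsupp.induction_linear with
      | zero => exact zero_mem _
      | add f g hf hg => exact add_mem hf hg
      | single a r =>
        induction r using GR.induction with
        | mem i r hr =>
          refine AddSubgroup.mem_iSup_of_mem (i + a.1) fun b => ?_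
          rw [Finsupp.single_apply]
          split_ifs with h
          · rw [← h, add_sub_cancel_right]; exact hr
          · exact zero_mem _
        | add r s hr hs => rw [Finsupp.single_add]; exact add_mem hr hs
    smul_mem := fun {i j p f} hp hf b => by
      rw [add_sub_assoc]
      exact GR.smul_mem hp (hf b) }

theorem freeGrading_proj_single (j : ℤ) (b : Σ j : ℤ, N.part j) (r : R) :
    (freeGrading GR N).proj j (Finsupp.single b r) = Finsupp.single b (GR.proj (j - b.1) r) := by
  change Finsupp.liftAddHom _ _ = _
  rw [Finsupp.liftAddHom_apply_single]
  rfl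

variable (G : Grading 𝓡 N.part)

theorem cover_single (b : Σ j : ℤ, N.part j) (r : R) :
    N.cover (Finsupp.single b r) = r • (b.2 : N.carrier) := by
  simp [cover]

include G in
theorem cover_surjective : Function.Surjective N.cover := fun m => by
  induction m using G.induction with
  | mem i m hm => exact ⟨Finsupp.single ⟨i, m, hm⟩ 1, by rw [cover_single, one_smul]⟩
  | add a b ha hb =>
    obtain ⟨f, rfl⟩ := ha
    obtain ⟨g, rfl⟩ := hb
    exact ⟨f + g, map_add _ _ _⟩

/-- The cover is homogeneous, which makes its kernel stable under the projections and hence graded.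
-/
theorem cover_proj (j : ℤ) (f : N.Free) :
    N.cover ((freeGrading GR N).proj j f) = G.proj j (N.cover f) := by
  induction f using Finsupp.induction_linear with
  | zero => simp
  | add f g hf hg => simp only [map_add, hf, hg]
  | single b r =>
    rw [freeGrading_proj_single, cover_single, cover_single, G.proj_smul_of_mem GR b.2.2]

/-- The grading of the first canonical syzygy module. -/
noncomputable def syzygyGrading : Grading 𝓡 (N.syzygy 𝓡).part :=
  let F := freeGrading GR N
  have hker : ∀ (j : ℤ) (z : LinearMap.ker N.cover), F.proj j z ∈ LinearMap.ker N.cover :=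
    fun j z => by rw [LinearMap.mem_ker, cover_proj GR G, LinearMap.mem_ker.1 z.2, map_zero]
  show Grading 𝓡 (M := LinearMap.ker N.cover) (fun j =>
      (N.freePart 𝓡 j).comap (LinearMap.ker N.cover).subtype.toAddMonoidHom) from
  { proj := fun j => AddMonoidHom.mk' (fun z => ⟨F.proj j z, hker j z⟩)
      fun a b => Subtype.ext (map_add (F.proj j) (a : N.Free) b)
    proj_mem := fun j z => F.proj_mem j z
    proj_self := fun {j z} hz => Subtype.ext (F.proj_self hz)
    proj_ne := fun {i j z} hz hij => Subtype.ext (F.proj_ne hz hij)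
    mem_iSup := fun z => by
      obtain ⟨s, hs⟩ := F.exists_sum (z : N.Free)
      have : z = ∑ j ∈ s, ⟨F.proj j z, hker j z⟩ := Subtype.ext (by
        rw [AddSubmonoidClass.coe_finsetSum]; exact hs)
      rw [this]
      exact sum_mem fun j _ => AddSubgroup.mem_iSup_of_mem j (F.proj_mem j z)
    smul_mem := fun {i j p z} hp hz => F.smul_mem hp hz }

/-- The gradings of the iterated syzygies. -/
noncomputable def iterSyzygyGrading : (i : ℕ) → Grading 𝓡 (N.iterSyzygy 𝓡 i).part
  | 0 => G
  | i + 1 => syzygyGrading GR (iterSyzygyGrading i)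

theorem single_mem_freePart (h1 : (1 : R) ∈ 𝓡 0) {j : ℤ} {m : N.carrier} (hm : m ∈ N.part j) :
    (Finsupp.single ⟨j, m, hm⟩ 1 : N.Free) ∈ N.freePart 𝓡 j := fun b => by
  classical
  rw [Finsupp.single_apply]
  split_ifs with h
  · rw [← h, sub_self]; exact h1
  · exact zero_mem _

theorem exists_mem_freePart (h1 : (1 : R) ∈ 𝓡 0) (j : ℤ) (m : N.carrier) (hm : m ∈ N.part j) :
    ∃ f ∈ N.freePart 𝓡 j, N.cover f = m :=
  ⟨_, single_mem_freePart h1 hm, by rw [cover_single, one_smul]⟩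

end GrMod

end KoszulReg

/-! ### Comparison of Tor with Koszul homology -/

namespace KoszulReg

theorem tmul_one_eq_zero_iff {R : Type u} [CommRing R] {F : Type v} [AddCommGroup F] [Module R F]
    (J : Ideal R) (f : F) : f ⊗ₜ[R] (1 : R ⧸ J) = 0 ↔ f ∈ J • (⊤ : Submodule R F) := by
  rw [← (TensorProduct.tensorQuotEquivQuotSMul F J).map_eq_zero_iff]
  have := TensorProduct.tensorQuotEquivQuotSMul_tmul_mk (M := F) J f 1
  rw [one_smul] at this
  rw [← Submodule.Quotient.mk_eq_zero, ← this]
  rfl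

theorem exists_tmul_one {R : Type u} [CommRing R] {F : Type v} [AddCommGroup F] [Module R F]
    (J : Ideal R) (z : F ⊗[R] (R ⧸ J)) : ∃ f : F, f ⊗ₜ[R] (1 : R ⧸ J) = z := by
  induction z using TensorProduct.induction_on with
  | zero => exact ⟨0, TensorProduct.zero_tmul _ _⟩
  | add a b ha hb =>
    obtain ⟨f, rfl⟩ := ha
    obtain ⟨g, rfl⟩ := hb
    exact ⟨f + g, TensorProduct.add_tmul _ _ _⟩
  | tmul f r =>
    obtain ⟨r, rfl⟩ := Ideal.Quotient.mk_surjective r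
    refine ⟨r • f, ?_⟩
    rw [TensorProduct.smul_tmul]
    congr 1
    rw [Algebra.smul_def, mul_one]
    rfl

namespace GrMod

variable {R : Type u} [CommRing R] {𝓡 : ℤ → AddSubgroup R} {N : GrMod R}

/-- A homogeneous element of a syzygy module that gives a trivial class in `Tor` lies in
`J` times the syzygy module. -/
theorem mem_smul_top_of_torPart_eq_bot (h1 : (1 : R) ∈ 𝓡 0) {J : Ideal R} {p : ℕ} {j : ℤ}
    (ht : N.torPart 𝓡 J p j = ⊥) {z : (N.iterSyzygy 𝓡 p).carrier}
    (hz : z ∈ (N.iterSyzygy 𝓡 p).part j)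
    (hc : (Finsupp.single ⟨j, z, hz⟩ 1 : N.Res 𝓡 p) ⊗ₜ[R] (1 : R ⧸ J) ∈ N.torCycles 𝓡 J p) :
    z ∈ J • (⊤ : Submodule R (N.iterSyzygy 𝓡 p).carrier) := by
  set u : N.Res 𝓡 p := Finsupp.single ⟨j, z, hz⟩ 1 with hu
  obtain ⟨w, hw⟩ : u ⊗ₜ[R] (1 : R ⧸ J) ∈ LinearMap.range (N.torD 𝓡 J p) :=
    subQuotPart_eq_bot_iff (A := N.TorChain 𝓡 J p) |>.1 ht _ hc ⟨u, single_mem_freePart h1 hz, rfl⟩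
  obtain ⟨v, rfl⟩ := exists_tmul_one J w
  have h2 : (u - N.resD 𝓡 p v) ⊗ₜ[R] (1 : R ⧸ J) = 0 := by
    rw [TensorProduct.sub_tmul, ← hw]
    exact sub_self _
  rw [tmul_one_eq_zero_iff] at h2
  have h3 := map_mem_smul_top (N.iterSyzygy 𝓡 p).cover h2
  have h4 : (N.iterSyzygy 𝓡 p).cover (N.resD 𝓡 p v) = 0 :=
    LinearMap.mem_ker.1 (((N.iterSyzygy 𝓡 p).syzygy 𝓡).cover v).2
  rwa [map_sub, h4, sub_zero, hu, cover_single, one_smul] at h3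

variable {n : ℕ} {x : Fin n → R} {d : Fin n → ℕ} (GR : Grading 𝓡 𝓡) (hx : ∀ t, x t ∈ 𝓡 (d t))
  (h1 : (1 : R) ∈ 𝓡 0) (hreg : QuasiRegular x R)

theorem exists_totalD_eq_of_mem {M : Type v} [AddCommGroup M] [Module R M]
    {c : Finset (Fin n) → M} (hc : ∀ σ, σ.card ≠ 0 → c σ = 0)
    (h : c ∅ ∈ Ideal.span (Set.range x) • (⊤ : Submodule R M)) : ∃ b, totalD x b = c := by
  obtain ⟨b, _, _, hb⟩ := exists_totalD_eq_single x (U := Finset.univ) (m := c ∅)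
    (by simpa using h)
  refine ⟨b, hb.trans (funext fun σ => ?_)⟩
  by_cases h : σ = ∅
  · rw [h, Pi.single_eq_same]
  · rw [Pi.single_eq_of_ne h, hc σ (by simpa using h)]

include hx h1 hreg GR

/-- Let N' be the p-th syzygy module, F' its cover, L the kernel and J = (x). By shifting, H_1(x,
N') is (L ∩ JF')/JL. For z in L ∩ JF', the basis element of F(L) over z maps to z, so it is a cycle
modulo J; the vanishing of Tor_{p+1} then puts z into JL. In homological degree 0 every chain is a
cycle, so it is essential that `ExactAt.shift` remembers that z bounds over F'. -/
theorem exactAt_one_of_torPart_eq_bot {p : ℕ} {j : ℤ}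
    (ht : N.torPart 𝓡 (Ideal.span (Set.range x)) (p + 1) j = ⊥) :
    ExactAt x d (N.iterSyzygy 𝓡 p).part 1 j := by
  refine ExactAt.shift (k := 0) (N.iterSyzygy 𝓡 p).cover
    ((freeGrading GR (N.iterSyzygy 𝓡 p)).smul_mem' hx) (exists_mem_freePart h1) (hreg.finsupp _) ?_
  rintro c hc hcj ⟨b, hb⟩
  refine exists_totalD_eq_of_mem hc ?_
  have hz : ((c ∅ : LinearMap.ker (N.iterSyzygy 𝓡 p).cover) : (N.iterSyzygy 𝓡 p).Free) ∈
      (N.iterSyzygy 𝓡 p).freePart 𝓡 j := by simpa using hcj ∅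
  have hJ : ((c ∅ : LinearMap.ker (N.iterSyzygy 𝓡 p).cover) : (N.iterSyzygy 𝓡 p).Free) ∈
      Ideal.span (Set.range x) • (⊤ : Submodule R (N.iterSyzygy 𝓡 p).Free) := by
    have := totalD_eq_sum_of_support x (U := Finset.univ) (c := b) (by simp)
    rw [hb] at this
    simpa using this
  refine mem_smul_top_of_torPart_eq_bot (N := N) (p := p + 1) h1 ht hz ?_
  change (N.torD 𝓡 _ p) _ = 0
  have : N.resD 𝓡 p (Finsupp.single ⟨j, c ∅, hz⟩ 1) = (c ∅ : (N.iterSyzygy 𝓡 p).Free) := by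
    refine congrArg (LinearMap.ker (N.iterSyzygy 𝓡 p).cover).subtype
      ((cover_single (N := (N.iterSyzygy 𝓡 p).syzygy 𝓡) _ _).trans ?_)
    rw [one_smul]
  rw [← tmul_one_eq_zero_iff, ← this] at hJ
  exact hJ

/-- The free cover is acyclic in positive degrees, so H_{k+1}(x, N) embeds in H_k(x, ker). -/
theorem exactAt_succ_of_syzygy {k : ℕ} {j : ℤ} (h : ExactAt x d (N.syzygy 𝓡).part k j) :
    ExactAt x d N.part (k + 1) j := by
  refine ExactAt.shift N.cover ((freeGrading GR N).smul_mem' hx) (exists_mem_freePart h1)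
    (hreg.finsupp _) ?_
  rintro c hc hcj ⟨b, hb⟩
  refine h c hc hcj (funext fun σ => Subtype.ext ?_)
  have := totalD_comp x (LinearMap.ker N.cover).subtype c
  rw [show (fun σ => (LinearMap.ker N.cover).subtype (c σ)) = totalD x b from hb.symm,
    totalD_totalD] at this
  exact (congrFun this σ).symm

theorem exactAt_add_of_iterSyzygy {k : ℕ} {j : ℤ} (b : ℕ) :
    ExactAt x d (N.iterSyzygy 𝓡 b).part k j → ExactAt x d N.part (k + b) j := by
  induction b generalizing k with
  | zero => exact id
  | succ b ih =>
    intro h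
    have := ih (exactAt_succ_of_syzygy GR hx h1 hreg h)
    rwa [add_right_comm, add_assoc] at this

/-- The canonical graded `Tor` controls Koszul homology. -/
theorem exactAt_of_torPart_eq_bot {p : ℕ} {j : ℤ}
    (ht : N.torPart 𝓡 (Ideal.span (Set.range x)) p j = ⊥) : ExactAt x d N.part p j := by
  cases p with
  | zero =>
    intro c hc hcj _
    refine exists_totalD_eq_of_mem hc ?_
    exact mem_smul_top_of_torPart_eq_bot (N := N) (p := 0) h1 ht
      (z := c ∅) (by have h := hcj ∅; rw [Finset.sum_empty, sub_zero] at h; exact h) trivial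
  | succ p =>
    rw [add_comm]
    exact exactAt_add_of_iterSyzygy GR hx h1 hreg p
      (exactAt_one_of_torPart_eq_bot GR hx h1 hreg ht)

omit hx h1 GR
-- The ungraded form of the same shift, used for vanishing above the projective dimension.
theorem exactAt_top_succ_of_syzygy (G : Grading 𝓡 N.part) {k : ℕ} {i : ℤ}
    (h : ExactAt x d (fun _ => (⊤ : AddSubgroup (N.syzygy 𝓡).carrier)) k i) :
    ExactAt x d (fun _ => (⊤ : AddSubgroup N.carrier)) (k + 1) i := by
  refine ExactAt.shift (𝓕 := fun _ => ⊤) N.cover (fun _ _ _ _ => trivial)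
    (fun _ m _ => (cover_surjective G m).imp fun f hf => ⟨trivial, hf⟩) (hreg.finsupp _) ?_
  rintro c hc _ ⟨b, hb⟩
  refine h c hc (fun _ => trivial) (funext fun σ => Subtype.ext ?_)
  have := totalD_comp x (LinearMap.ker N.cover).subtype c
  rw [show (fun σ => (LinearMap.ker N.cover).subtype (c σ)) = totalD x b from hb.symm,
    totalD_totalD] at this
  exact (congrFun this σ).symm

include GR in
theorem exactAt_top_add_of_iterSyzygy (G : Grading 𝓡 N.part) {k : ℕ} {i : ℤ} (b : ℕ) :
    ExactAt x d (fun _ => (⊤ : AddSubgroup (N.iterSyzygy 𝓡 b).carrier)) k i →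
      ExactAt x d (fun _ => (⊤ : AddSubgroup N.carrier)) (k + b) i := by
  induction b generalizing k with
  | zero => exact id
  | succ b ih =>
    intro h
    have := ih (exactAt_top_succ_of_syzygy hreg (iterSyzygyGrading GR G b) h)
    rwa [add_right_comm, add_assoc] at this

end GrMod

/-- A projective module is a retract of a free one, and quasi-regularity passes to retracts. -/
theorem QuasiRegular.of_projective {R : Type u} [CommRing R] {n : ℕ} {x : Fin n → R}
    (hreg : QuasiRegular x R) (P : Type v) [AddCommGroup P] [Module R P] [Module.Projective R P] :
    QuasiRegular x P := by
  obtain ⟨s, hs⟩ := Module.projective_def'.1 ‹Module.Projective R P›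
  exact (hreg.finsupp P).of_retract s (Finsupp.linearCombination R id)
    fun m => LinearMap.congr_fun hs m

/-! ### Projective dimension and vanishing of Koszul homology -/

namespace GrMod

open CategoryTheory

variable {R : Type u} [CommRing R] {𝓡 : ℤ → AddSubgroup R} (GR : Grading 𝓡 𝓡) {N : GrMod R}

theorem hasProjectiveDimensionLT_syzygy (G : Grading 𝓡 N.part) {m : ℕ}
    (h : HasProjectiveDimensionLT (ModuleCat.of R N.carrier) (m + 2)) :
    HasProjectiveDimensionLT (ModuleCat.of R (N.syzygy 𝓡).carrier) (m + 1) := by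
  have hex : Function.Exact (LinearMap.ker N.cover).subtype N.cover :=
    LinearMap.exact_subtype_ker_map _
  let S : ShortComplex (ModuleCat.{u} R) :=
    ModuleCat.shortComplexOfCompEqZero
      (M := ModuleCat.of R (LinearMap.ker N.cover)) (LinearMap.ker N.cover).subtype N.cover
      hex.linearMap_comp_eq_zero
  have hS : S.ShortExact :=
    { exact := ModuleCat.shortComplex_exact _ hex
      mono_f := (ModuleCat.mono_iff_injective _).2 (Submodule.injective_subtype _)
      epi_g := (ModuleCat.epi_iff_surjective _).2 (cover_surjective G) }
  have hP : Projective S.X₂ := inferInstanceAs (Projective (ModuleCat.of R N.Free))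
  exact hS.hasProjectiveDimensionLT_X₁ (m + 1)
    (hasProjectiveDimensionLT_of_ge _ 1 _ (by omega)) h

include GR in
theorem hasProjectiveDimensionLT_iterSyzygy (G : Grading 𝓡 N.part) (b : ℕ) {m : ℕ}
    (h : HasProjectiveDimensionLT (ModuleCat.of R N.carrier) (m + 1 + b)) :
    HasProjectiveDimensionLT (ModuleCat.of R (N.iterSyzygy 𝓡 b).carrier) (m + 1) := by
  induction b generalizing m with
  | zero => exact h
  | succ b ih =>
    refine hasProjectiveDimensionLT_syzygy (iterSyzygyGrading GR G b) (ih ?_)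
    rwa [add_assoc (m + 1), add_comm 1 b]

include GR in
/-- Koszul homology vanishes above the projective dimension. -/
theorem exactAt_top_of_projectiveDimension {n : ℕ} {x : Fin n → R} {d : Fin n → ℕ}
    (hreg : QuasiRegular x R) (G : Grading 𝓡 N.part) {p : ℕ}
    (h : HasProjectiveDimensionLT (ModuleCat.of R N.carrier) (p + 1)) {i : ℕ} (hi : p < i)
    (j : ℤ) : ExactAt x d (fun _ => (⊤ : AddSubgroup N.carrier)) i j := by
  -- The p-th syzygy module is projective, hence acyclic for the Koszul complex; p dimension shifts
  -- carry the vanishing back to N.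
  have h1 : HasProjectiveDimensionLT (ModuleCat.of R (N.iterSyzygy 𝓡 p).carrier) 1 :=
    hasProjectiveDimensionLT_iterSyzygy GR G p (m := 0) (by rwa [zero_add, add_comm])
  have h2 := projective_iff_hasProjectiveDimensionLT_one.2 h1
  have h3 : Module.Projective R (N.iterSyzygy 𝓡 p).carrier :=
    ModuleCat.projective_of_module_projective
      (ModuleCat.of R (N.iterSyzygy 𝓡 p).carrier)
  obtain ⟨k, rfl⟩ := Nat.exists_eq_add_of_lt hi
  have := exactAt_top_add_of_iterSyzygy GR hreg G p
    ((hreg.of_projective (N.iterSyzygy 𝓡 p).carrier).exactAt d (fun _ => ⊤) k j)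
  rwa [show k + 1 + p = p + k + 1 by omega] at this

end GrMod

end KoszulReg

/-! ### Grade and dimension -/

namespace KoszulReg

open CategoryTheory

theorem supportDim_le_of_support_subset {R : Type u} [CommRing R] {M : Type v} [AddCommGroup M]
    [Module R M] {N : Type w} [AddCommGroup N] [Module R N]
    (h : Module.support R M ⊆ Module.support R N) :
    Module.supportDim R M ≤ Module.supportDim R N :=
  Order.krullDim_le_of_strictMono (Set.inclusion h) fun _ _ h => h

/-- The vanishing of `Ext^i(M, N)` for `i < p` bounds the dimension of `M`. -/
theorem supportDim_add_le_of_subsingleton_ext {R : Type u} [CommRing R] [IsNoetherianRing R]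
    {M : Type u} [AddCommGroup M] [Module R M] [Module.Finite R M] (p : ℕ) :
    ∀ (N : Type u) [AddCommGroup N] [Module R N] [Module.Finite R N],
      Module.support R M ⊆ Module.support R N →
      (∀ i < p, Subsingleton (Abelian.Ext.{u} (ModuleCat.of R M) (ModuleCat.of R N) i)) →
      Module.supportDim R M + p ≤ Module.supportDim R N := by
  induction p with
  | zero =>
    intro N _ _ _ h _
    simpa using supportDim_le_of_support_subset h
  | succ p ih =>
    intro N _ _ _ h hext
    have h0 : Subsingleton (M →ₗ[R] N) := by
      have := hext 0 (by omega)
      have e := (Abelian.Ext.addEquiv₀ (X := ModuleCat.of R M) (Y := ModuleCat.of R N)).symm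
      have := e.toEquiv.subsingleton
      exact (ModuleCat.homEquiv (M := ModuleCat.of R M) (N := ModuleCat.of R N)).symm.subsingleton
    -- Hom(M, N) = 0 provides an N-regular element of Ann M. Dividing N by it lowers dim N by at
    -- least one, keeps Supp M inside the support, and costs one degree of Ext vanishing.
    obtain ⟨r, hr, hreg⟩ := IsSMulRegular.subsingleton_linearMap_iff.1 h0
    have hS := IsSMulRegular.smulShortComplex_shortExact (M := ModuleCat.of R N) hreg
    have h1 := ih (QuotSMulTop r N) (fun q hq => by
        rw [Module.support_quotSMulTop]
        refine ⟨h hq, ?_⟩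
        rw [PrimeSpectrum.mem_zeroLocus, Set.singleton_subset_iff]
        exact Module.mem_support_iff_of_finite.1 hq hr)
      (fun i hi => by
        have := hext (i + 1) (by omega)
        have := hext i (by omega)
        refine ⟨fun a b => ?_⟩
        have key : ∀ a : Abelian.Ext.{u} (ModuleCat.of R M)
            ((ModuleCat.of R N).smulShortComplex r).X₃ i, a = 0 := fun a => by
          obtain ⟨c, rfl⟩ := Abelian.Ext.covariant_sequence_exact₃ _ hS a rfl
            (Subsingleton.elim (α := Abelian.Ext.{u} (ModuleCat.of R M) (ModuleCat.of R N) (i + 1))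
              _ _)
          rw [show c = 0 from
            Subsingleton.elim (α := Abelian.Ext.{u} (ModuleCat.of R M) (ModuleCat.of R N) i) _ _,
            Abelian.Ext.zero_comp]
        exact (key a).trans (key b).symm)
    calc Module.supportDim R M + ((p + 1 : ℕ) : WithBot ℕ∞)
        = Module.supportDim R M + p + 1 := by push_cast; rw [add_assoc]
      _ ≤ Module.supportDim R (QuotSMulTop r N) + 1 := by gcongr
      _ ≤ _ := Module.supportDim_quotSMulTop_succ_le_of_notMem_minimalPrimes
        fun _ => hreg.notMem_of_mem_minimalPrimes

theorem supportDim_add_le_of_moduleGrade {R : Type u} [CommRing R] [IsNoetherianRing R]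
    {M : Type u} [AddCommGroup M] [Module R M] [Module.Finite R M] {p : ℕ}
    (h : moduleGrade R M = p) : Module.supportDim R M + p ≤ ringKrullDim R := by
  rw [← Module.supportDim_self_eq_ringKrullDim]
  refine supportDim_add_le_of_subsingleton_ext p R (fun q _ => ?_) fun i hi => ?_
  · rw [Module.mem_support_iff_of_finite]
    intro a ha
    have := Module.mem_annihilator.1 ha 1
    rw [smul_eq_mul, mul_one] at this
    exact this ▸ zero_mem _
  · by_contra hn
    rw [not_subsingleton_iff_nontrivial] at hn
    have : moduleGrade R M ≤ i := iInf₂_le i hn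
    rw [h] at this
    exact absurd (by exact_mod_cast this) (not_le.2 hi)

theorem supportDim_le_of_isPerfectOfGrade {n : ℕ} {K : Type u} [Field K] {M : Type u}
    [AddCommGroup M] [Module (Poly n K) M] [Module.Finite (Poly n K) M] {p : ℕ}
    (h : moduleGrade (Poly n K) M = p) :
    Module.supportDim (Poly n K) M ≤ ((n - p : ℕ) : WithBot ℕ∞) := by
  have h1 := supportDim_add_le_of_moduleGrade h
  rw [MvPolynomial.ringKrullDim_of_isNoetherianRing, ringKrullDim_eq_zero_of_field, zero_add,
    Nat.card_fin] at h1
  generalize Module.supportDim (Poly n K) M = a at h1 ⊢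
  induction a with
  | bot => exact bot_le
  | coe a =>
    have h2 : a + p ≤ n := by exact_mod_cast h1
    induction a with
    | top => simp at h2
    | coe a =>
      have h3 : a + p ≤ n := by exact_mod_cast h2
      have h4 : a ≤ n - p := by omega
      generalize n - p = q at h4 ⊢
      exact_mod_cast h4

end KoszulReg

/-! ### Regularity of torsion modules -/

namespace KoszulReg

section Reg

variable {R : Type u} [CommRing R] {𝓡 : ℤ → AddSubgroup R} {n : ℕ} {y : Fin n → R}
  {N : Type v} [AddCommGroup N] [Module R N] {𝓝 : ℤ → AddSubgroup N}

theorem subsingleton_cechLoc (h : ∀ s (m : N), ∃ e : ℕ, y s ^ e • m = 0) {σ : Finset (Fin n)}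
    (hσ : σ.card ≠ 0) : Subsingleton (CechLoc y N σ) := by
  obtain ⟨s, hs⟩ := Finset.card_ne_zero.1 hσ
  rw [LocalizedModule.subsingleton_iff]
  intro m
  obtain ⟨e, he⟩ := h s m
  exact ⟨y s ^ e, pow_mem (Submonoid.subset_closure (Set.mem_image_of_mem y hs)) e, he⟩

theorem eq_one_of_mem_cechMonoid {σ : Finset (Fin n)} (hσ : σ.card = 0) {p : R}
    (hp : p ∈ cechMonoid y σ) : p = 1 := by
  rw [Finset.card_eq_zero] at hσ
  subst hσ
  simpa [cechMonoid] using hp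

/-- The regularity of a module annihilated by the `y s` is at least the degree of each of its
nonzero components. -/
theorem le_cechReg (h1 : (1 : R) ∈ 𝓡 0) (h : ∀ s (m : N), y s • m = 0) {j : ℤ} (hj : 𝓝 j ≠ ⊥) :
    ((j : ℝ) : EReal) ≤ cechReg 𝓡 y 𝓝 := by
  have key : localCohomologyPart 𝓡 y 𝓝 0 j ≠ ⊥ := by
    rw [localCohomologyPart, Ne, subQuotPart_eq_bot_iff]
    intro hbot
    refine hj (eq_bot_iff.2 fun z hz => AddSubgroup.mem_bot.2 ?_)
    have hc := hbot (fun σ => LocalizedModule.mk z 1)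
      (LinearMap.mem_ker.2 (funext fun τ => by
        have := subsingleton_cechLoc (y := y) (N := N) (fun s m => ⟨1, by rw [pow_one, h]⟩)
          (σ := τ.1) (by rw [τ.2]; simp)
        exact Subsingleton.elim _ _))
      (fun σ => AddSubgroup.subset_closure ⟨1, 0, z, h1, by rwa [add_zero], rfl⟩)
    have h0 : LocalizedModule.mk z 1 = (0 : CechLoc y N ∅) :=
      congrFun ((Submodule.mem_bot R).1 hc) ⟨∅, rfl⟩
    rw [← LocalizedModule.zero_mk 1, LocalizedModule.mk_eq] at h0
    obtain ⟨u, hu⟩ := h0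
    have hu1 : u = 1 := Subtype.ext (eq_one_of_mem_cechMonoid (y := y) rfl u.2)
    simpa [hu1] using hu
  refine le_trans ?_ (le_iSup₂ (f := fun (i : ℕ) (j : ℤ) =>
    ⨆ (_ : localCohomologyPart 𝓡 y 𝓝 i j ≠ ⊥), (((i + j : ℤ) : ℝ) : EReal)) 0 j)
  refine le_trans ?_ (le_iSup _ key)
  simp

/-- The regularity of a torsion module is bounded by a bound on its degrees. -/
theorem cechReg_le (h1 : ∀ e, (1 : R) ∈ 𝓡 e → e = 0) (h : ∀ s (m : N), ∃ e : ℕ, y s ^ e • m = 0)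
    {b : EReal} (hb : ∀ j : ℤ, ¬ ((j : ℝ) : EReal) ≤ b → 𝓝 j = ⊥) : cechReg 𝓡 y 𝓝 ≤ b := by
  refine iSup_le fun i => iSup_le fun j => iSup_le fun hne => ?_
  by_contra hlt
  refine hne ?_
  rw [localCohomologyPart, subQuotPart_eq_bot_iff]
  intro z _ hz
  suffices hz0 : z = 0 by rw [hz0]; exact zero_mem _
  funext σ
  rw [Pi.zero_apply]
  cases i with
  | succ i =>
    have := subsingleton_cechLoc (y := y) h (σ := σ.1) (by rw [σ.2]; simp)
    exact Subsingleton.elim _ _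
  | zero =>
    have hj := hb j (by simpa using hlt)
    have hle : cechLocPart 𝓡 y 𝓝 σ.1 j ≤ ⊥ := by
      refine (AddSubgroup.closure_le _).2 ?_
      rintro _ ⟨p, e, m, hpe, hm, rfl⟩
      -- Over the empty set the only denominator is 1, whose degree is forced to be 0, so the
      -- numerators have degree exactly j.
      rw [eq_one_of_mem_cechMonoid σ.2 p.2] at hpe
      rw [h1 e hpe, add_zero, hj, AddSubgroup.mem_bot] at hm
      rw [hm, LocalizedModule.zero_mk]
      exact zero_mem _
    exact AddSubgroup.mem_bot.1 (hle (hz σ))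

end Reg

end KoszulReg

/-! ### Homogeneous regular elements, artinian graded modules, radicals -/

namespace KoszulReg

open MvPolynomial in
/-- Homogeneous prime avoidance in a polynomial ring. -/
theorem exists_homogeneous_notMem {n : ℕ} {K : Type u} [Field K] (T : Finset (Ideal (Poly n K))) :
    (∀ P ∈ T, P.IsPrime ∧ ¬ irrelevant n K ≤ P) →
      ∃ (e : ℕ) (y : Poly n K), 0 < e ∧ y.IsHomogeneous e ∧ y ∈ irrelevant n K ∧
        ∀ P ∈ T, y ∉ P := by
  classical
  induction T using Finset.strongInduction with
  | H T ih =>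
    intro hT
    rcases T.eq_empty_or_nonempty with rfl | ⟨P, hP⟩
    · exact ⟨1, 0, one_pos, isHomogeneous_zero _ _ _, zero_mem _, by simp⟩
    rcases (T.erase P).eq_empty_or_nonempty with hE | hE
    · have h1 := (hT P hP).2
      rw [irrelevant, Ideal.span_le, Set.not_subset] at h1
      obtain ⟨_, ⟨s, rfl⟩, hs⟩ := h1
      refine ⟨1, X s, one_pos, isHomogeneous_X _ _, Ideal.subset_span ⟨s, rfl⟩, fun Q hQ => ?_⟩
      have : Q = P := by
        by_contra h
        have : Q ∈ T.erase P := Finset.mem_erase.2 ⟨h, hQ⟩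
        simp [hE] at this
      rwa [this]
    have step : ∀ Q ∈ T, ∃ (e : ℕ) (y : Poly n K), 0 < e ∧ y.IsHomogeneous e ∧
        y ∈ irrelevant n K ∧ ∀ P ∈ T.erase Q, y ∉ P := fun Q hQ =>
      ih _ (Finset.erase_ssubset hQ) fun P hP => hT P (Finset.mem_of_mem_erase hP)
    choose! e y he hy hyi hyP using step
    by_cases hex : ∃ Q ∈ T, y Q ∉ Q
    · obtain ⟨Q, hQ, hyQ⟩ := hex
      refine ⟨e Q, y Q, he Q hQ, hy Q hQ, hyi Q hQ, fun P hP => ?_⟩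
      by_cases h : P = Q
      · rwa [h]
      · exact hyP Q hQ P (Finset.mem_erase.2 ⟨h, hP⟩)
    push Not at hex
    set z := ∏ Q ∈ T.erase P, y Q with hz
    set b := ∑ Q ∈ T.erase P, e Q with hb
    have hzb : z.IsHomogeneous b :=
      IsHomogeneous.prod _ _ _ fun Q hQ => hy Q (Finset.mem_of_mem_erase hQ)
    have hb0 : 0 < b := Finset.sum_pos (fun Q hQ => he Q (Finset.mem_of_mem_erase hQ)) hE
    have hzP : z ∉ P := fun h => by
      have := (hT P hP).1
      obtain ⟨Q, hQ, hQP⟩ := (Ideal.IsPrime.prod_mem_iff).1 h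
      have hQ' := Finset.mem_erase.1 hQ
      exact hyP Q hQ'.2 P (Finset.mem_erase.2 ⟨hQ'.1.symm, hP⟩) hQP
    have hzQ : ∀ Q ∈ T.erase P, z ∈ Q := fun Q hQ =>
      Ideal.mem_of_dvd _ (Finset.dvd_prod_of_mem y hQ) (hex Q (Finset.mem_of_mem_erase hQ))
    -- Each y_Q lies in Q and in no other member of T. The exponents equalize degrees: y_P^b lies
    -- only in P, while the power of the product z lies in every member except P, so the sum avoids
    -- them all.
    refine ⟨e P * b, y P ^ b + z ^ e P, Nat.mul_pos (he P hP) hb0, ((hy P hP).pow b).add ?_,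
      add_mem (Ideal.pow_mem_of_mem _ (hyi P hP) _ hb0) (Ideal.pow_mem_of_mem _ ?_ _ (he P hP)), ?_⟩
    · rw [mul_comm]
      exact hzb.pow _
    · obtain ⟨Q, hQ⟩ := hE
      exact Ideal.mem_of_dvd _ (Finset.dvd_prod_of_mem y hQ) (hyi Q (Finset.mem_of_mem_erase hQ))
    · intro Q hQ h
      have := (hT Q hQ).1
      by_cases hQP : Q = P
      · subst hQP
        refine hzP (this.mem_of_pow_mem (e Q) ?_)
        exact (Ideal.add_mem_iff_right _ (Ideal.pow_mem_of_mem _ (hex Q hQ) _ hb0)).1 h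
      · have hQE := Finset.mem_erase.2 ⟨hQP, hQ⟩
        refine hyP P hP Q hQE (this.mem_of_pow_mem b ?_)
        exact (Ideal.add_mem_iff_left _ (Ideal.pow_mem_of_mem _ (hzQ Q hQE) _ (he P hP))).1 h

section GradedPoly

variable {n : ℕ} {K : Type u} [Field K] {M : Type v} [AddCommGroup M] [Module (Poly n K) M]

/-- An associated prime Ann(m) containing S₊ would make m a nonzero socle element. Hence homogeneous
prime avoidance applies to the finitely many associated primes, whose union is the set of zero
divisors. -/
theorem exists_homogeneous_isSMulRegular [Module.Finite (Poly n K) M]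
    (hsoc : ∀ m : M, (∀ s : Fin n, (MvPolynomial.X s : Poly n K) • m = 0) → m = 0) :
    ∃ (e : ℕ) (y : Poly n K), 0 < e ∧ y.IsHomogeneous e ∧ y ∈ irrelevant n K ∧
      IsSMulRegular M y := by
  obtain ⟨e, y, he, hy, hyi, hyT⟩ := exists_homogeneous_notMem
    (associatedPrimes.finite (Poly n K) M).toFinset (fun P hP => by
      rw [Set.Finite.mem_toFinset] at hP
      refine ⟨hP.isPrime, fun hle => ?_⟩
      obtain ⟨hprime, m, rfl⟩ := isAssociatedPrime_iff.1 hP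
      have hm : m = 0 := hsoc m fun s => by
        simpa using hle (Ideal.subset_span ⟨s, rfl⟩)
      exact hprime.ne_top ((Ideal.eq_top_iff_one _).2 (by simp [hm])))
  refine ⟨e, y, he, hy, hyi, ?_⟩
  by_contra hreg
  have : y ∈ ⋃ p ∈ associatedPrimes (Poly n K) M, (p : Set (Poly n K)) := by
    rw [biUnion_associatedPrimes_eq_compl_regular]
    exact hreg
  simp only [Set.mem_iUnion] at this
  obtain ⟨P, hP, hyP⟩ := this
  exact hyT P (by simpa using hP) hyP

variable {𝓜 : ℤ → AddSubgroup M}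

/-- S is concentrated in degrees ≥ 0, so the elements without components below b form a submodule;
one of these contains a finite generating set. -/
theorem Grading.exists_lower_bound (G : Grading (polyPart n K) 𝓜) [Module.Finite (Poly n K) M] :
    ∃ j₀ : ℤ, ∀ j < j₀, 𝓜 j = ⊥ := by
  classical
  let B : ℤ → Submodule (Poly n K) M := fun b =>
    { carrier := {m | ∀ j < b, G.proj j m = 0}
      add_mem' := fun h₁ h₂ j hj => by rw [map_add, h₁ j hj, h₂ j hj, add_zero]
      zero_mem' := fun j _ => map_zero _
      smul_mem' := fun r m hm => by
        induction r using (polyGrading n K).induction with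
        | add r s hr hs => exact fun j hj => by rw [add_smul, map_add, hr j hj, hs j hj, add_zero]
        | mem i r hr =>
          intro j hj
          rcases lt_or_ge i 0 with hi | hi
          · rw [polyPart_of_neg hi, AddSubgroup.mem_bot] at hr
            rw [hr, zero_smul, map_zero]
          · rw [G.proj_smul hr, hm _ (by omega), smul_zero] }
  have hB : ∀ {a b}, a ≤ b → B b ≤ B a := fun hab m hm j hj => hm j (by omega)
  have hone : ∀ m, ∃ b, m ∈ B b := fun m => by
    obtain ⟨s, hs⟩ := G.exists_sum m
    obtain ⟨b, hb⟩ := s.bddBelow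
    refine ⟨b, fun j hj => ?_⟩
    rw [hs, map_sum]
    refine Finset.sum_eq_zero fun i hi => G.proj_ne (G.proj_mem i m) ?_
    have := hb hi
    omega
  have hfin : ∀ S : Finset M, ∃ b, ∀ m ∈ S, m ∈ B b := fun S => by
    induction S using Finset.induction_on with
    | empty => exact ⟨0, by simp⟩
    | insert m S _ ih =>
      obtain ⟨b, hb⟩ := ih
      obtain ⟨c, hc⟩ := hone m
      refine ⟨min b c, fun m' hm' => ?_⟩
      rcases Finset.mem_insert.1 hm' with rfl | h
      · exact hB (min_le_right _ _) hc
      · exact hB (min_le_left _ _) (hb _ h)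
  obtain ⟨S, hS⟩ := Module.Finite.fg_top (R := Poly n K) (M := M)
  obtain ⟨b, hb⟩ := hfin S
  have htop : ∀ m, m ∈ B b := fun m =>
    (hS ▸ Submodule.span_le.2 hb : (⊤ : Submodule (Poly n K) M) ≤ B b) trivial
  refine ⟨b, fun j hj => eq_bot_iff.2 fun m hm => ?_⟩
  rw [AddSubgroup.mem_bot, ← G.proj_self hm]
  exact htop m j hj

/-- On an artinian finitely generated graded module the variables act nilpotently. -/
theorem Grading.exists_X_pow_smul_eq_zero (G : Grading (polyPart n K) 𝓜)
    [Module.Finite (Poly n K) M] [IsArtinian (Poly n K) M] (s : Fin n) :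
    ∃ e : ℕ, ∀ m : M, (MvPolynomial.X s : Poly n K) ^ e • m = 0 := by
  obtain ⟨j₀, hj₀⟩ := G.exists_lower_bound
  obtain ⟨e, he⟩ := IsArtinian.range_smul_pow_stabilizes M (MvPolynomial.X s : Poly n K)
  have hX : ∀ i : ℕ, (MvPolynomial.X s : Poly n K) ^ i ∈ polyPart n K (i : ℤ) := fun i => by
    have := (MvPolynomial.isHomogeneous_X K s).pow i
    rw [one_mul] at this
    exact mem_polyPart_natCast.2 this
  refine ⟨e, fun m => ?_⟩
  induction m using G.induction with
  | add a b ha hb => rw [smul_add, ha, hb, add_zero]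
  | mem j m hm =>
    -- By stability of the images, X^e m is also X^(e+t) m'. Comparing degrees, m' may be replaced
    -- by its component of degree j - t, which is zero for large t.
    obtain ⟨t, ht⟩ : ∃ t : ℕ, j - t < j₀ := ⟨(j - j₀ + 1).toNat, by omega⟩
    obtain ⟨m', hm'⟩ : ∃ m', (MvPolynomial.X s : Poly n K) ^ (e + t) • m' =
        (MvPolynomial.X s : Poly n K) ^ e • m := by
      have h1 : (MvPolynomial.X s : Poly n K) ^ e • m ∈ LinearMap.range
          ((MvPolynomial.X s : Poly n K) ^ e • (LinearMap.id : M →ₗ[Poly n K] M)) := ⟨m, rfl⟩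
      rw [he (e + t) (by omega)] at h1
      exact h1
    have h2 := G.proj_self (G.smul_mem (hX e) hm)
    rw [← hm', G.proj_smul (hX (e + t))] at h2
    rw [← hm', ← h2]
    have h3 := G.proj_mem (↑e + j - ↑(e + t)) m'
    rw [hj₀ _ (by push_cast; omega), AddSubgroup.mem_bot] at h3
    rw [h3, smul_zero]

theorem isArtinian_of_supportDim_le_zero {R : Type u} [CommRing R] [IsNoetherianRing R]
    {M : Type v} [AddCommGroup M] [Module R M] [Module.Finite R M]
    (h : Module.supportDim R M ≤ 0) : IsArtinian R M := by
  rw [Module.supportDim_eq_ringKrullDim_quotient_annihilator] at h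
  have h0 : Ring.KrullDimLE 0 (R ⧸ Module.annihilator R M) := Ring.krullDimLE_iff.2 (by simpa using h)
  have hA : IsArtinianRing (R ⧸ Module.annihilator R M) :=
    IsNoetherianRing.isArtinianRing_of_krullDimLE_zero
  have ht : Module.IsTorsionBySet R M (Module.annihilator R M) :=
    (Module.isTorsionBySet_annihilator R M)
  let := ht.module
  have := ht.isScalarTower (S := R)
  have : Module.Finite (R ⧸ Module.annihilator R M) M :=
    Module.Finite.of_restrictScalars_finite R _ _
  exact isArtinian_of_surjective_algebraMap (R := R ⧸ Module.annihilator R M)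
    Ideal.Quotient.mk_surjective

/-- If the socle of a graded torsion module vanishes in large degrees, so does the module. -/
theorem Grading.eq_zero_of_socle (G : Grading (polyPart n K) 𝓜) {β : ℤ}
    (htors : ∀ s : Fin n, ∃ e : ℕ, ∀ m : M, (MvPolynomial.X s : Poly n K) ^ e • m = 0)
    (hsoc : ∀ j > β, ∀ m ∈ 𝓜 j, (∀ s : Fin n, (MvPolynomial.X s : Poly n K) • m = 0) → m = 0)
    {j : ℤ} (hj : β < j) {m : M} (hm : m ∈ 𝓜 j) : m = 0 := by
  classical
  suffices ∀ (V : Finset (Fin n)) (j : ℤ), β < j → ∀ m ∈ 𝓜 j,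
      (∀ s ∉ V, (MvPolynomial.X s : Poly n K) • m = 0) → m = 0 from
    this Finset.univ j hj m hm (by simp)
  intro V
  induction V using Finset.induction_on with
  | empty => exact fun j hj m hm h => hsoc j hj m hm fun s => h s (by simp)
  | insert t V _ ih =>
    intro j hj m hm h
    -- V holds the variables not yet known to kill m. Peeling off powers of X_t, X_t^q m is killed
    -- by X_t and by the variables outside V, in a degree that is still above β, so `ih` kills it.
    have key : ∀ q : ℕ, (MvPolynomial.X t : Poly n K) ^ q • m = 0 → m = 0 := fun q => by
      induction q with
      | zero => exact fun h0 => by simpa using h0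
      | succ q ihq =>
        refine fun h0 => ihq (ih (q + j) (by omega) _ (G.smul_mem ?_ hm) fun s hs => ?_)
        · have := (MvPolynomial.isHomogeneous_X K t).pow q
          rw [one_mul] at this
          exact mem_polyPart_natCast.2 this
        · by_cases hst : s = t
          · rw [hst, smul_smul, ← pow_succ', h0]
          · rw [smul_comm, h s (by simp [hst, hs]), smul_zero]
    obtain ⟨e, he⟩ := htors t
    exact key e (he m)

end GradedPoly

/-- If a power of `z` maps `M` into `I M`, then `z` lies in the radical of `I + Ann M`. -/
theorem mem_radical_of_smul_mem {R : Type u} [CommRing R] {M : Type v} [AddCommGroup M] [Module R M]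
    [Module.Finite R M] {I : Ideal R} {z : R} (h : ∀ m : M, z • m ∈ I • (⊤ : Submodule R M)) :
    z ∈ (I ⊔ Module.annihilator R M).radical := by
  obtain ⟨p, hp, -, hpI, hp0⟩ :=
    LinearMap.exists_monic_and_natDegree_eq_and_coeff_mem_pow_and_aeval_eq_zero R
      (algebraMap R (Module.End R M) z) I (by
        rintro _ ⟨m, rfl⟩
        exact h m)
  rw [Polynomial.aeval_algebraMap_apply_eq_algebraMap_eval] at hp0
  have hann : p.eval z ∈ Module.annihilator R M := Module.mem_annihilator.2 fun m =>
    LinearMap.congr_fun hp0 m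
  refine ⟨p.natDegree, ?_⟩
  rw [Polynomial.eval_eq_sum_range, Finset.sum_range_succ, hp.coeff_natDegree, one_mul] at hann
  have hI : ∑ i ∈ Finset.range p.natDegree, p.coeff i * z ^ i ∈ I := sum_mem fun i hi => by
    refine Ideal.mul_mem_right _ _ (Ideal.pow_le_self ?_ (hpI i))
    have := Finset.mem_range.1 hi
    omega
  have := sub_mem (Ideal.mem_sup_right hann : _ ∈ I ⊔ Module.annihilator R M)
    (Ideal.mem_sup_left hI)
  rwa [add_sub_cancel_left] at this

/-- The sum of the values of an antitone function over a `k`-element set is at most the sum of its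
first `k` values. -/
theorem sum_le_sum_filter_lt {l : ℕ} {d : Fin l → ℕ} (hd : Antitone d) (σ : Finset (Fin l)) {k : ℕ}
    (hk : σ.card ≤ k) : ∑ s ∈ σ, d s ≤ ∑ i : Fin l with i.val < k, d i := by
  -- The i-th smallest element of σ is at least i, so its degree is at most d i.
  have hemb : ∀ i : Fin σ.card, i.val ≤ (σ.orderEmbOfFin rfl i).val := fun i => by
    have h : ∀ (i : ℕ) (hi : i < σ.card), i ≤ (σ.orderEmbOfFin rfl ⟨i, hi⟩).val := fun i => by
      induction i with
      | zero => exact fun _ => Nat.zero_le _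
      | succ i ih =>
        intro hi
        have h1 := ih (by omega)
        have h2 : σ.orderEmbOfFin rfl ⟨i, by omega⟩ < σ.orderEmbOfFin rfl ⟨i + 1, hi⟩ :=
          (σ.orderEmbOfFin rfl).strictMono (by simp)
        have h3 : (σ.orderEmbOfFin rfl ⟨i, by omega⟩).val <
          (σ.orderEmbOfFin rfl ⟨i + 1, hi⟩).val := h2
        omega
    exact h i.1 i.2
  have hcl : σ.card ≤ l := by simpa using σ.card_le_univ
  calc ∑ s ∈ σ, d s = ∑ i : Fin σ.card, d (σ.orderEmbOfFin rfl i) := by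
        conv_lhs => rw [← σ.image_orderEmbOfFin_univ rfl]
        rw [Finset.sum_image (fun _ _ _ _ h => (σ.orderEmbOfFin rfl).injective h)]
    _ ≤ ∑ i : Fin σ.card, d (Fin.castLE hcl i) := Finset.sum_le_sum fun i _ => hd (hemb i)
    _ = ∑ i ∈ Finset.univ.image (Fin.castLE hcl), d i := by
        rw [Finset.sum_image (fun _ _ _ _ h => Fin.castLE_injective hcl h)]
    _ ≤ _ := by
        refine Finset.sum_le_sum_of_subset fun i hi => ?_
        obtain ⟨i, -, rfl⟩ := Finset.mem_image.1 hi
        simp only [Finset.mem_filter, Finset.mem_univ, true_and, Fin.val_castLE]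
        omega

end KoszulReg

/-! ### The induction on dimension and the main theorem -/

namespace KoszulReg

section Main

variable {n : ℕ} {K : Type u} [Field K]

/-- The top Koszul homology on the variables is the socle. -/
theorem ExactAt.eq_zero_of_X_smul {M : Type v} [AddCommGroup M] [Module (Poly n K) M]
    {𝓜 : ℤ → AddSubgroup M} {j : ℤ}
    (h : ExactAt (MvPolynomial.X : Fin n → Poly n K) (fun _ => 1) 𝓜 n (j + n)) {m : M}
    (hm : m ∈ 𝓜 j) (hs : ∀ s : Fin n, (MvPolynomial.X s : Poly n K) • m = 0) : m = 0 := by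
  -- The chain m e₁ ∧ ⋯ ∧ e_n has degree j + n and is a cycle; there are no chains above it, so it
  -- bounds only if m = 0.
  obtain ⟨b, hb⟩ := h (Pi.single Finset.univ m) (fun σ hσ => Pi.single_eq_of_ne (by
      rintro rfl
      simp at hσ) _) (fun σ => by
      by_cases hσ : σ = Finset.univ
      · subst hσ
        simpa using hm
      · rw [Pi.single_eq_of_ne hσ]
        exact zero_mem _) (by
      funext σ
      rw [totalD_apply]
      refine Finset.sum_eq_zero fun t _ => ?_
      by_cases hσ : insert t σ = Finset.univ
      · rw [hσ, Pi.single_eq_same, mul_smul, hs, smul_zero]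
      · rw [Pi.single_eq_of_ne hσ, smul_zero])
  have := congrFun hb Finset.univ
  rw [totalD_apply, Pi.single_eq_same, Finset.compl_univ, Finset.sum_empty] at this
  exact this.symm

open scoped Pointwise in
/-- Vanishing of the Koszul homology of `x` in large degrees, from a bound on the last nonvanishing
Koszul homology on the variables and on the dimension. -/
theorem exactAt_of_supportDim_le {l : ℕ} {x : Fin l → Poly n K} {d : Fin l → ℕ}
    (hx : ∀ i, (x i).IsHomogeneous (d i)) (hd : Antitone d) (r : ℕ) :
    ∀ (M : Type v) [AddCommGroup M] [Module (Poly n K) M] [Module.Finite (Poly n K) M]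
      (𝓜 : ℤ → AddSubgroup M) (_ : Grading (polyPart n K) 𝓜) (τ : ℤ) (k : ℕ) (j : ℤ),
      r ≤ n → Module.supportDim (Poly n K) M ≤ (r : WithBot ℕ∞) →
      irrelevant n K ≤ (Ideal.span (Set.range x) ⊔ Module.annihilator (Poly n K) M).radical →
      (∀ i, n < i + r → ExactAt (MvPolynomial.X : Fin n → Poly n K) (fun _ => 1)
        (fun _ => (⊤ : AddSubgroup M)) i 0) →
      (∀ i, i + r = n → ∀ q > τ, ExactAt (MvPolynomial.X : Fin n → Poly n K) (fun _ => 1) 𝓜 i q) →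
      ((∑ i : Fin l with i.val < k + r, d i : ℕ) : ℤ) + τ - n < j → ExactAt x d 𝓜 k j := by
  have hxd : ∀ t, x t ∈ polyPart n K (d t) := fun t => mem_polyPart_natCast.2 (hx t)
  induction r with
  | zero =>
    intro M _ _ _ 𝓜 G τ k j _ hdim _ _ htop hj c hck hcj _
    have := isArtinian_of_supportDim_le_zero (R := Poly n K) (M := M) (by simpa using hdim)
    -- The socle in degree i is H_n(X, M) in degree i + n, which is zero as soon as i + n > τ.
    have hzero : ∀ i, τ - n < i → ∀ m ∈ 𝓜 i, m = 0 := fun i hi m hm =>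
      G.eq_zero_of_socle (fun s => G.exists_X_pow_smul_eq_zero s)
        (fun j hj m hm hs => (htop n rfl (j + n) (by omega)).eq_zero_of_X_smul hm hs) hi hm
    refine ⟨0, ?_⟩
    rw [map_zero]
    funext σ
    rw [Pi.zero_apply]
    by_cases hσ : σ.card = k
    · refine (hzero _ ?_ _ (hcj σ)).symm
      have := sum_le_sum_filter_lt hd σ hσ.le
      rw [add_zero] at hj
      zify at this hj
      linarith
    · exact (hck σ hσ).symm
  | succ r ih =>
    intro M _ _ _ 𝓜 G τ k j hr hdim hI hvan htop hj
    -- The dimension parameter is now positive, so `hvan` covers i = n: M has no socle.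
    obtain ⟨e₀, y₀, -, hy₀, hy₀I, hreg₀⟩ := exists_homogeneous_isSMulRegular (n := n) (K := K)
      (M := M) fun m hs => (hvan n (by omega)).of_top (𝓜 := fun _ => ⊤) (0 + n)
        |>.eq_zero_of_X_smul trivial hs
    -- The exponent t may be 0. Then y = 1 and M/yM = 0, whose support dimension ⊥ is handled below.
    obtain ⟨t, ht⟩ := hI hy₀I
    set y := y₀ ^ t with hy
    set e : ℤ := ((e₀ * t : ℕ) : ℤ) with he
    have hye : y ∈ polyPart n K e := mem_polyPart_natCast.2 (hy₀.pow t)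
    have hreg : IsSMulRegular M y := hreg₀.pow t
    set π := (y • (⊤ : Submodule (Poly n K) M)).mkQ with hπdef
    have hπ : ∀ m, π m = 0 ↔ ∃ b, y • b = m := fun m => by
      rw [hπdef, Submodule.mkQ_apply, Submodule.Quotient.mk_eq_zero,
        Submodule.mem_smul_pointwise_iff_exists]
      simp
    have hX := G.smul_mem' (d := fun _ : Fin n => 1) X_mem_polyPart
    refine ExactAt.of_quotient (M' := QuotSMulTop y M) π
      (𝓜' := fun j => (𝓜 j).map (y • (⊤ : Submodule (Poly n K) M)).mkQ.toAddMonoidHom)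
      hreg hπ (Submodule.mkQ_surjective _) (fun i m hm => ⟨m, hm, rfl⟩)
      (e := e) (fun i m hm => by rw [add_comm]; exact G.smul_mem hye hm)
      (fun c hc => exists_totalD_eq_smul_of_mem_sup x ht hc)
      (G.exists_homogeneous_totalD_eq hxd) ?_
    -- Both k + r and j - τ are the same as before, so the numerical hypothesis carries over.
    refine ih (QuotSMulTop y M) _ (G.quotient (y • ⊤) fun j m hm => ?_) (τ + e) (k + 1) (j + e)
      (by omega) ?_ ?_ ?_ ?_ ?_
    · obtain ⟨b, -, rfl⟩ := (Submodule.mem_smul_pointwise_iff_exists _ _ _).1 hm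
      rw [G.proj_smul hye]
      exact Submodule.smul_mem_pointwise_smul _ _ _ trivial
    · have h1 := (Module.supportDim_quotSMulTop_succ_le_of_notMem_minimalPrimes
        fun _ => hreg.notMem_of_mem_minimalPrimes).trans hdim
      generalize Module.supportDim (Poly n K) (QuotSMulTop y M) = a at h1 ⊢
      induction a with
      | bot => exact bot_le
      | coe a =>
        have h2 : a + 1 ≤ (r + 1 : ℕ) := by exact_mod_cast h1
        induction a with
        | top => simp at h2
        | coe a =>
          have h3 : a + 1 ≤ r + 1 := by exact_mod_cast h2
          have h4 : a ≤ r := by omega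
          exact_mod_cast h4
    · exact hI.trans (Ideal.radical_mono (sup_le_sup_left
        (LinearMap.annihilator_le_of_surjective π (Submodule.mkQ_surjective _)) _))
    · intro i hi
      obtain ⟨i, rfl⟩ : ∃ i', i = i' + 1 := ⟨i - 1, by omega⟩
      exact ExactAt.quotient (M' := QuotSMulTop y M) π (𝓜 := fun _ => ⊤) (e := 0) (i := 0) hreg
        (fun _ _ _ _ => trivial) hπ
        (fun _ m _ => (Submodule.mkQ_surjective _ m).imp fun _ h => ⟨trivial, h⟩)
        (fun _ _ _ => trivial) (hvan _ (by omega)) ((hvan i (by omega)).of_top _)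
    -- The only nonzero neighbour in the long exact sequence is H_{i-1}(X, M) in degree q - e, which
    -- vanishes because q - e > τ.
    · intro i hi q hq
      obtain ⟨i, rfl⟩ : ∃ i', i = i' + 1 := ⟨i - 1, by omega⟩
      exact ExactAt.quotient (M' := QuotSMulTop y M) π (e := e) (i := 0) hreg hX hπ
        (fun _ m hm => hm) (G.mem_of_smul_mem hye hreg) (hvan _ (by omega))
        (htop i (by omega) _ (by omega))
    · rw [show k + 1 + r = k + (r + 1) by omega]
      omega

theorem subQuot_smul_eq_zero {R : Type u} [CommRing R] {A : Type v} [AddCommGroup A] [Module R A]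
    {Z B : Submodule R A} {r : R} (h : ∀ a : A, r • a = 0) (m : SubQuot Z B) : r • m = 0 := by
  obtain ⟨z, rfl⟩ := Submodule.mkQ_surjective _ m
  rw [← map_smul, show r • z = 0 from Subtype.ext (h z), map_zero]

/-- The variables kill F ⊗ S/S₊ and hence Tor, so every degree in which Tor is nonzero is at most
its regularity. -/
theorem GrMod.torPart_eq_bot {M : Type u} [AddCommGroup M] [Module (Poly n K) M]
    (𝓜 : ℤ → AddSubgroup M) {p : ℕ} {j : ℤ}
    (h : ¬ ((j : ℝ) : EReal) ≤ tReg (n := n) (K := K) 𝓜 p) :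
    (GrMod.mk (R := Poly n K) M 𝓜).torPart (polyPart n K) (irrelevant n K) p j = ⊥ := by
  by_contra hne
  refine h (le_cechReg one_mem_polyPart (fun s => ?_) hne)
  refine subQuot_smul_eq_zero (A := (GrMod.mk (R := Poly n K) M 𝓜).TorChain (polyPart n K)
    (irrelevant n K) p) fun a => ?_
  obtain ⟨f, rfl⟩ := exists_tmul_one _ a
  rw [TensorProduct.smul_tmul', tmul_one_eq_zero_iff]
  exact Submodule.smul_mem_smul (Ideal.subset_span ⟨s, rfl⟩) trivial

theorem eq_zero_of_one_mem_polyPart {e : ℤ} (h : (1 : Poly n K) ∈ polyPart n K e) : e = 0 := by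
  rcases lt_or_ge e 0 with he | he
  · rw [polyPart_of_neg he, AddSubgroup.mem_bot] at h
    exact absurd h one_ne_zero
  · lift e to ℕ using he
    exact_mod_cast (mem_polyPart_natCast.1 h).inj_right (MvPolynomial.isHomogeneous_one _ _)
      one_ne_zero

end Main

end KoszulReg

/-! ### The regularity bound -/

open KoszulReg in
theorem theorem1p1 {K : Type u} [Field K] {n : ℕ}
    -- a homogeneous ideal and homogeneous generators in order of decreasing degree
    (I : Ideal (KoszulReg.Poly n K)) {l : ℕ} (x : Fin l → KoszulReg.Poly n K) (d : Fin l → ℕ)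
    (hx : ∀ i, (x i).IsHomogeneous (d i)) (hd : Antitone d) (hI : Ideal.span (Set.range x) = I)
    (g : ℕ) (hg : KoszulReg.idealGrade (KoszulReg.Poly n K) I = g)
    -- a finitely generated graded module
    {M : Type u} [AddCommGroup M] [Module (KoszulReg.Poly n K) M]
    [Module.Finite (KoszulReg.Poly n K) M]
    (𝓜 : ℤ → AddSubgroup M) (h𝓜 : KoszulReg.IsGradedModule (KoszulReg.polyPart n K) 𝓜)
    (hM : KoszulReg.IsPerfectOfGrade (KoszulReg.Poly n K) M (n - g))
    (hlen : Module.length (KoszulReg.Poly n K)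
      (M ⧸ (I • (⊤ : Submodule (KoszulReg.Poly n K) M))) ≠ ⊤)
    (k : ℕ) :
    KoszulReg.reg (n := n) (K := K) (KoszulReg.koszulHomologyPart x d 𝓜 k) ≤
      ((∑ i : Fin l with i.val < g + k, d i : ℕ) : EReal)
        + KoszulReg.tReg (n := n) (K := K) 𝓜 (n - g) - (n : EReal) := by
  subst hI
  have hxd : ∀ t, x t ∈ polyPart n K (d t) := fun t => mem_polyPart_natCast.2 (hx t)
  have G := Grading.ofIsGradedModule h𝓜
  have hrad : irrelevant n K ≤
      (Ideal.span (Set.range x) ⊔ Module.annihilator (Poly n K) M).radical := by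
    rw [irrelevant, Ideal.span_le]
    rintro _ ⟨s, rfl⟩
    -- M/IM is a graded artinian module, so some X_s^e maps M into IM, and the determinant trick
    -- applies.
    have := (isFiniteLength_iff_isNoetherian_isArtinian.1 (Module.length_ne_top_iff.1 hlen)).2
    obtain ⟨e, he⟩ := (G.quotient _ fun j _ hm =>
      G.proj_mem_smul_top hxd j hm).exists_X_pow_smul_eq_zero s
    refine Ideal.radical_isRadical _ ⟨e, mem_radical_of_smul_mem fun m => ?_⟩
    rw [← Submodule.Quotient.mk_eq_zero, Submodule.Quotient.mk_smul]
    exact he _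
  set p := n - g with hp
  have hpd : CategoryTheory.HasProjectiveDimensionLT (ModuleCat.of (Poly n K) M) (p + 1) :=
    (CategoryTheory.projectiveDimension_le_iff _ _).1 hM.2.le
  -- With truncated subtraction n - p is min(n, g), so only k + (n - p) ≤ g + k is available; it
  -- suffices.
  have hgk : ∑ i : Fin l with i.val < k + (n - p), d i ≤ ∑ i : Fin l with i.val < g + k, d i :=
    Finset.sum_le_sum_of_subset fun i hi => by
      simp only [Finset.mem_filter, Finset.mem_univ, true_and] at hi ⊢
      omega
  refine cechReg_le (fun e => eq_zero_of_one_mem_polyPart) (fun s m => ?_) fun j hj => ?_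
  · obtain ⟨e, he⟩ := hrad (Ideal.subset_span ⟨s, rfl⟩)
    exact ⟨e, smul_koszulHomology_eq_zero x he m⟩
  · refine koszulHomologyPart_eq_bot x d ?_
    -- With D the sum of the first g + k degrees, τ = j - D + n - 1 is the largest integer with D +
    -- τ - n < j. Any q > τ has j ≤ D + q - n, so q ≤ t_p(M) would contradict `hj`; hence Tor_p
    -- vanishes in degree q.
    refine exactAt_of_supportDim_le hx hd (n - p) M 𝓜 G
      (j - (∑ i : Fin l with i.val < g + k, d i : ℕ) + n - 1) k j (by omega)
      (supportDim_le_of_isPerfectOfGrade hM.1) hrad (fun i hi => ?_) (fun i hi q hq => ?_) ?_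
    · exact GrMod.exactAt_top_of_projectiveDimension (N := ⟨M, 𝓜⟩) (polyGrading n K) quasiRegular_X
        G hpd (by omega) 0
    · obtain rfl : i = p := by omega
      refine GrMod.exactAt_of_torPart_eq_bot (N := ⟨M, 𝓜⟩) (polyGrading n K) X_mem_polyPart
        one_mem_polyPart quasiRegular_X (GrMod.torPart_eq_bot 𝓜 fun hle => hj ?_)
      generalize (∑ i : Fin l with i.val < g + k, d i) = D at hq ⊢
      have h1 : (j : ℝ) ≤ D + q - n := by
        have : j ≤ D + q - n := by omega
        exact_mod_cast this
      calc ((j : ℝ) : EReal) ≤ ((D + q - n : ℝ) : EReal) := EReal.coe_le_coe_iff.2 h1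
        _ = (D : EReal) + ((q : ℝ) : EReal) - (n : EReal) := by
            rw [EReal.coe_sub, EReal.coe_add]
            rfl
        _ ≤ _ := EReal.sub_le_sub (add_le_add le_rfl hle) le_rfl
    · omega
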